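/- Let $(R,\mathfrak m)$ be a Noetherian local ring of dimension $3$ that is a local hypersurface, i.e. $\hat R\cong T/(f)$ for some complete regular local ring $T$ and some nonzero element $f$ of the maximal ideal of $T$. Let $N$ be a nonzero finitely generated reflexive $R$-module which is locally free on the punctured spectrum $U_R=\operatorname{Spec}(R)\setminus\{\mathfrak m\}$, i.e. $N_{\mathfrak p}$ is a free $R_{\mathfrak p}$-module for every prime $\mathfrak p\neq\mathfrak m$. Write $N^*=\operatorname{Hom}_R(N,R)$, let $\ell$ denote length, and let $$\theta^R(N^*,N)=\ell\big(\operatorname{Tor}^R_{2e+2}(N^*,N)\big)-\ell\big(\operatorname{Tor}^R_{2e+1}(N^*,N)\big)$$ be Hochster's theta function, where $e$ is any integer with $2e\ge\dim R$ (the lengths are finite and the value does not depend on $e$). Assume that $\theta^R(N^*,N)=0$. Then $\operatorname{Hom}_R(N,N)$ is a maximal Cohen--Macaulay $R$-module (that is, finitely generated with $\operatorname{depth}\operatorname{Hom}_R(N,N)=\dim R$) if and only if $N$ is free. -/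

import Mathlib

universe u v

open CategoryTheory IsLocalRing

/-- A (Noetherian) local ring `R` is a *local hypersurface* if its completion is isomorphic to
`T / (f)` for a complete regular local ring `T` and a nonzero `f` in the maximal ideal of `T`. -/
def IsLocalHypersurface (R : Type u) [CommRing R] [IsLocalRing R] : Prop :=
  ∃ (T : Type u) (_ : CommRing T) (_ : IsRegularLocalRing T) (f : T),
    IsAdicComplete (maximalIdeal T) T ∧ f ∈ maximalIdeal T ∧ f ≠ 0 ∧
      Nonempty (AdicCompletion (maximalIdeal R) R ≃+* T ⧸ Ideal.span {f})

/-- The depth of a finitely generated module `M` over a local ring `R`: the supremum of the lengths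
of the `M`-regular sequences in the maximal ideal. For `M ≠ 0` finitely generated, weakly regular
sequences in the maximal ideal are regular by Nakayama's lemma; the depth of `0` is `⊤`. -/
noncomputable def localDepth (R : Type u) [CommRing R] [IsLocalRing R]
    (M : Type v) [AddCommGroup M] [Module R M] : ℕ∞ :=
  ⨆ rs : {rs : List R //
      (∀ r ∈ rs, r ∈ maximalIdeal R) ∧ RingTheory.Sequence.IsWeaklyRegular M rs},
    (rs.1.length : ℕ∞)

/-- A maximal Cohen-Macaulay module: finitely generated with depth equal to `dim R`.
The zero module (of depth `⊤`) is not maximal Cohen-Macaulay. -/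
def IsMaximalCohenMacaulay (R : Type u) [CommRing R] [IsLocalRing R]
    (M : Type v) [AddCommGroup M] [Module R M] : Prop :=
  Module.Finite R M ∧ (localDepth R M : WithBot ℕ∞) = ringKrullDim R

/-- `M` is locally free on the punctured spectrum: `M_p` is free over `R_p` for every prime `p`
different from the maximal ideal. -/
def IsLocallyFreeOnPuncturedSpectrum (R : Type u) [CommRing R] [IsLocalRing R]
    (M : Type v) [AddCommGroup M] [Module R M] : Prop :=
  ∀ (p : Ideal R) [p.IsPrime], p ≠ maximalIdeal R →
    Module.Free (Localization.AtPrime p) (LocalizedModule p.primeCompl M)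

/-- The length of `Tor_i^R(M, N)`. -/
noncomputable def torLength (R : Type u) [CommRing R] (i : ℕ)
    (M N : Type u) [AddCommGroup M] [Module R M] [AddCommGroup N] [Module R N] : ℕ∞ :=
  Module.length R (((Tor (ModuleCat.{u} R) i).obj (ModuleCat.of R M)).obj (ModuleCat.of R N))

/-- Hochster's theta function
`θ^R(M, N) = ℓ(Tor_{2e+2}^R(M, N)) - ℓ(Tor_{2e+1}^R(M, N))`, where `e` is any integer with
`2e ≥ dim R`. It is used over a local hypersurface, for `M` and `N` such that these lengths are
finite; the value then does not depend on `e`. -/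
noncomputable def hochsterTheta (R : Type u) [CommRing R] (e : ℕ)
    (M N : Type u) [AddCommGroup M] [Module R M] [AddCommGroup N] [Module R N] : ℤ :=
  ((torLength R (2 * e + 2) M N).toNat : ℤ) - ((torLength R (2 * e + 1) M N).toNat : ℤ)

set_option linter.unusedSectionVars false

/-! If `N` is free, then `Hom(N, N)` is free and nonzero, and `R` has a regular sequence of length
3, so `Hom(N, N)` is maximal Cohen-Macaulay. The content is the converse, which combines rigidity
with a Herbrand quotient.

Let `p : P → N` be a minimal free cover with kernel `K`. The cokernel of `Hom(P, N) → Hom(K, N)` is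
`Ext¹(N, N)`. It is killed by a power of `𝔪`, because `N` is locally free on the punctured spectrum.
Since `N` is a second syzygy and `Hom(N, N)` has depth 3, a depth count gives this cokernel positive
depth, so it is zero (`exists_extension_of_extVanishes`).

Now pass to the completion `S = T/(f)`, which is flat with `𝔪_R S = 𝔪_S`; lengths of Tor and the
extension property survive. Since `T` has global dimension 4 and `K` is a third syzygy over `S`, `K`
has projective dimension at most 1 over `T`. It is therefore the cokernel of a matrix factorization
`(A, B)` of `f` (`exists_isPeriodicResolution`). With `u : Sⁿ → Sᵇ` of image `K`, the matrices `u,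
A, B, A, B, …` resolve `N`, and everything becomes matrix algebra.

Multiplication by `A` and `B` on matrices whose rows lie in `N*` or in `K*` gives two-periodic
complexes. For `N*` the homology is even and odd `Tor(N*, N)`. For `K*` it is `Ext¹(ΩK, ΩK)` in one
parity and the stable endomorphisms of `K` in the other. The sequence `0 → N* → (Sᵇ)* → K* → Ext¹(N,
S) → 0` has an exact complex on `(Sᵇ)*` and a cokernel of finite length, so `θ(N*, N) = 0` passes to
`K*`: if one homology vanishes there, so does the other. `Ext¹(N, N) = 0` gives `Ext¹(K, K) = 0`,
and rotating the matrix factorization gives `Ext¹(ΩK, ΩK) = 0`. Hence the identity of `K` is stably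
zero, that is `B = B Y B` (`exists_eq_mul_mul_self`).

So `K` is projective. As every map `K → N` extends to `Sᵇ` and `K ⊆ 𝔪 Sᵇ`, minimality forces `K = 0`
(`eq_zero_of_ext_eq_zero_of_theta_eq_zero`), and `p` is an isomorphism by faithful flatness. -/

namespace Submodule

/-! ### Relative lengths of submodules -/

section RelLength

variable {R M M' : Type*} [CommRing R] [AddCommGroup M] [Module R M] [AddCommGroup M'] [Module R M']

/-- The length of `P / (P ⊓ Q)`. -/
noncomputable def relLength (Q P : Submodule R M) : ℕ∞ :=
  Module.length R (P ⧸ Q.submoduleOf P)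

lemma relLength_eq_zero_iff {Q P : Submodule R M} : Q.relLength P = 0 ↔ P ≤ Q := by
  rw [relLength, Module.length_eq_zero_iff, Submodule.Quotient.subsingleton_iff,
    Submodule.submoduleOf_eq_top]

lemma relLength_eq_of_surjective {Q P : Submodule R M} {Q' P' : Submodule R M'} (f : P →ₗ[R] P')
    (hf : Function.Surjective f) (h : ∀ x, (f x : M') ∈ Q' ↔ (x : M) ∈ Q) :
    Q.relLength P = Q'.relLength P' := by
  have hker : Q.submoduleOf P = LinearMap.ker ((Q'.submoduleOf P').mkQ ∘ₗ f) := by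
    ext x
    simp only [LinearMap.mem_ker, LinearMap.comp_apply, Submodule.mkQ_apply,
      Submodule.Quotient.mk_eq_zero]
    exact (h x).symm
  exact ((Submodule.quotEquivOfEq _ _ hker).trans (LinearMap.quotKerEquivOfSurjective _
    ((Submodule.mkQ_surjective _).comp hf))).length_eq

lemma relLength_comap (f : M →ₗ[R] M') (Q : Submodule R M') (P : Submodule R M) :
    (Q.comap f).relLength P = Q.relLength (P.map f) :=
  relLength_eq_of_surjective (f.submoduleMap P) (f.submoduleMap_surjective P) fun x ↦ by simp

lemma relLength_map_map (f : M →ₗ[R] M') (Q P : Submodule R M) :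
    (Q.map f).relLength (P.map f) = (Q ⊔ LinearMap.ker f).relLength P := by
  rw [← relLength_comap, Submodule.comap_map_eq]

lemma relLength_inf_right (Q P : Submodule R M) : (Q ⊓ P).relLength P = Q.relLength P :=
  relLength_eq_of_surjective LinearMap.id Function.surjective_id fun x ↦ by simp

lemma relLength_sup_right (Q P : Submodule R M) : Q.relLength (P ⊔ Q) = Q.relLength P := by
  have := relLength_comap Q.mkQ ⊥ (P ⊔ Q)
  rw [Submodule.map_sup, Submodule.mkQ_map_self, sup_bot_eq, ← relLength_comap] at this
  simpa using this

lemma relLength_add {Q P N : Submodule R M} (h₁ : Q ≤ P) (h₂ : P ≤ N) :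
    Q.relLength N = Q.relLength P + P.relLength N := by
  have hi : Q.submoduleOf P ≤ (Q.submoduleOf N).comap (Submodule.inclusion h₂) := fun x hx ↦ hx
  have hj : Q.submoduleOf N ≤ (P.submoduleOf N).comap LinearMap.id := fun x hx ↦ h₁ hx
  refine Module.length_eq_add_of_exact (Submodule.mapQ _ _ (Submodule.inclusion h₂) hi)
    (Submodule.mapQ _ _ LinearMap.id hj) ?_ ?_ ?_
  · rw [← LinearMap.ker_eq_bot, Submodule.ker_mapQ]
    exact Submodule.mkQ_map_self _
  · rintro ⟨x⟩
    exact ⟨Submodule.Quotient.mk x, rfl⟩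
  · rintro ⟨x⟩
    constructor
    · intro hx
      have hx' : (x : M) ∈ P := (Submodule.Quotient.mk_eq_zero (P.submoduleOf N)).1 hx
      exact ⟨Submodule.Quotient.mk ⟨x, hx'⟩, rfl⟩
    · rintro ⟨⟨y⟩, hy⟩
      rw [← hy]
      exact (Submodule.Quotient.mk_eq_zero _).2 y.2

end RelLength

/-! ### Herbrand quotients of two-periodic complexes -/

section Herbrand

variable {R M : Type*} [CommRing R] [AddCommGroup M] [Module R M]

/-- The length of the homology `ker α / im β` of two endomorphisms restricted to `V`. -/
noncomputable def homologyLength (α β : M →ₗ[R] M) (V : Submodule R M) : ℕ∞ :=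
  (V.map β).relLength (V ⊓ LinearMap.ker α)

/-- The length of the homology `ker α / im β` of two endomorphisms on the quotient `V / W`. -/
noncomputable def quotientHomologyLength (α β : M →ₗ[R] M) (W V : Submodule R M) : ℕ∞ :=
  (V.map β ⊔ W).relLength (V ⊓ W.comap α)

variable {α β : M →ₗ[R] M} {V W : Submodule R M}

/-- This lemma and the next two encode the exact hexagon of `0 → W → V → V/W → 0`: each homology
length is the sum of the lengths of two consecutive images. Here these are the image of `H(W)` in
`H(V)` and the image of `H(V)` in `H(V/W)`. -/
lemma homologyLength_eq_add (hWV : W ≤ V) (hβ : V.map β ≤ V) (hαβ : V.map β ≤ LinearMap.ker α) :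
    homologyLength α β V = (V.map β).relLength (W ⊓ LinearMap.ker α) +
      (V.map β ⊔ W).relLength (V ⊓ LinearMap.ker α) := by
  have h : V.map β ≤ V ⊓ LinearMap.ker α := le_inf hβ hαβ
  have h' : W ⊓ LinearMap.ker α ≤ V ⊓ LinearMap.ker α := inf_le_inf_right _ hWV
  rw [homologyLength, relLength_add (P := W ⊓ LinearMap.ker α ⊔ V.map β) le_sup_right
    (sup_le h' h), relLength_sup_right]
  congr 1
  rw [← relLength_inf_right (V.map β ⊔ W), sup_inf_assoc_of_le W h, sup_comm, ← inf_assoc,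
    inf_eq_left.2 hWV]

/-- The second summand is the length of the image of the connecting map `H(V/W) → H(W)`. -/
lemma quotientHomologyLength_eq_add (hWV : W ≤ V) (hβ : V.map β ≤ V) (hαW : W.map α ≤ W)
    (hαβ : V.map β ≤ LinearMap.ker α) :
    quotientHomologyLength α β W V = (V.map β ⊔ W).relLength (V ⊓ LinearMap.ker α) +
      (V ⊓ LinearMap.ker α ⊔ W).relLength (V ⊓ W.comap α) := by
  rw [quotientHomologyLength, relLength_add (P := V ⊓ LinearMap.ker α ⊔ W)
    (sup_le_sup_right (le_inf hβ hαβ) _)]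
  · congr 1
    rw [← relLength_sup_right (V.map β ⊔ W) (V ⊓ LinearMap.ker α), ← sup_assoc]
    congr 2
    exact (sup_eq_left.2 (le_inf hβ hαβ)).symm
  · exact sup_le (inf_le_inf_left _ (LinearMap.ker_le_comap _))
      (le_inf hWV (Submodule.map_le_iff_le_comap.1 hαW))

lemma homologyLength_eq_add' (hWV : W ≤ V) (hαW : W.map α ≤ W)
    (hβα : V.map α ≤ LinearMap.ker β) :
    homologyLength β α W = (V.map α).relLength (W ⊓ LinearMap.ker β) +
      (V ⊓ LinearMap.ker α ⊔ W).relLength (V ⊓ W.comap α) := by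
  have h1 : (V ⊓ W.comap α).map α = V.map α ⊓ W := by
    ext x
    constructor
    · rintro ⟨y, ⟨h, h'⟩, rfl⟩
      exact ⟨⟨y, h, rfl⟩, h'⟩
    · rintro ⟨⟨y, h, rfl⟩, h'⟩
      exact ⟨y, ⟨h, h'⟩, rfl⟩
  rw [homologyLength, relLength_add (P := V.map α ⊓ W)
    (le_inf (Submodule.map_mono hWV) hαW)
    (le_inf inf_le_right (inf_le_left.trans hβα)), add_comm]
  congr 1
  · rw [← relLength_inf_right, ← relLength_inf_right (V.map α)]
    congr 1
    rw [inf_assoc, ← inf_assoc W, inf_idem]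
  · rw [← h1, relLength_map_map, ← relLength_inf_right, ← relLength_inf_right (_ ⊔ W)]
    congr 1
    have hW : W ≤ V ⊓ W.comap α := le_inf hWV (Submodule.map_le_iff_le_comap.1 hαW)
    rw [sup_comm (V ⊓ _), sup_inf_assoc_of_le _ hW, sup_inf_assoc_of_le _ hW]
    congr 1
    rw [inf_comm V (LinearMap.ker α), inf_assoc, ← inf_assoc V V, inf_idem]

/-- When `H(V)` vanishes in both parities the connecting map is an isomorphism, and it exchanges the
parities. -/
lemma quotientHomologyLength_eq_of_homologyLength_eq_zero (hWV : W ≤ V)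
    (hα : V.map α ≤ V) (hβ : V.map β ≤ V) (hαW : W.map α ≤ W)
    (hαβ : V.map β ≤ LinearMap.ker α) (hβα : V.map α ≤ LinearMap.ker β)
    (h : homologyLength α β V = 0) (h' : homologyLength β α V = 0) :
    quotientHomologyLength α β W V = homologyLength β α W := by
  rw [homologyLength_eq_add hWV hβ hαβ, add_eq_zero] at h
  rw [homologyLength_eq_add hWV hα hβα, add_eq_zero] at h'
  rw [quotientHomologyLength_eq_add hWV hβ hαW hαβ, homologyLength_eq_add' hWV hαW hβα, h.2, h'.1]

/-- A finite length complex has trivial Herbrand quotient: the filtration `W ≤ βV + W ≤ V ∩ α⁻¹W ≤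
V` writes the length of `V/W` as the homology length plus the lengths of the images of `α` and `β`,
which is symmetric apart from the homology. -/
lemma quotientHomologyLength_comm (hWV : W ≤ V)
    (hα : V.map α ≤ V) (hβ : V.map β ≤ V) (hαW : W.map α ≤ W) (hβW : W.map β ≤ W)
    (hαβ : V.map β ≤ LinearMap.ker α) (hβα : V.map α ≤ LinearMap.ker β)
    (hfin : W.relLength V ≠ ⊤) :
    quotientHomologyLength α β W V = quotientHomologyLength β α W V := by
  have key : ∀ (α β : M →ₗ[R] M), V.map α ≤ V → V.map β ≤ V → W.map α ≤ W →
      V.map β ≤ LinearMap.ker α →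
      W.relLength V = W.relLength (V.map β) + quotientHomologyLength α β W V +
        W.relLength (V.map α) := by
    intro α β hα hβ hαW hαβ
    rw [relLength_add (P := V.map β ⊔ W) le_sup_right (sup_le hβ hWV), relLength_sup_right,
      relLength_add (P := V ⊓ W.comap α) (N := V) _ inf_le_left, ← add_assoc,
      inf_comm V (W.comap α), relLength_inf_right, relLength_comap, quotientHomologyLength,
      inf_comm V (W.comap α)]
    exact sup_le (le_inf hβ (hαβ.trans (LinearMap.ker_le_comap _)))
      (le_inf hWV (Submodule.map_le_iff_le_comap.1 hαW))
  have h1 := key α β hα hβ hαW hαβ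
  have h2 := key β α hβ hα hβW hβα
  have ha : W.relLength (V.map β) ≠ ⊤ := by
    intro h; rw [h] at h1; simp at h1; exact hfin h1
  have hb : W.relLength (V.map α) ≠ ⊤ := by
    intro h; rw [h] at h1; simp at h1; exact hfin h1
  rw [h1, add_comm (W.relLength (V.map α)) , add_assoc, add_assoc,
    add_comm (W.relLength (V.map β)), add_assoc] at h2
  exact WithTop.add_right_cancel (WithTop.add_ne_top.2 ⟨hb, ha⟩) h2

/-- If two complexes given by `α`, `β` on `W ≤ V` differ by a module of finite length, and the
Herbrand quotient of `W` is trivial, then vanishing of one homology of `V` implies that of the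
other. -/
lemma homologyLength_eq_zero_of_finite_quotient (hWV : W ≤ V)
    (hα : V.map α ≤ V) (hβ : V.map β ≤ V) (hαW : W.map α ≤ W) (hβW : W.map β ≤ W)
    (hαβ : V.map β ≤ LinearMap.ker α) (hβα : V.map α ≤ LinearMap.ker β)
    (hfin : W.relLength V ≠ ⊤) (hW : homologyLength α β W = homologyLength β α W)
    (hW' : homologyLength β α W ≠ ⊤) (h : homologyLength β α V = 0) :
    homologyLength α β V = 0 := by
  have hq := quotientHomologyLength_comm hWV hα hβ hαW hβW hαβ hβα hfin
  rw [homologyLength_eq_add hWV hα hβα, add_eq_zero] at h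
  rw [quotientHomologyLength_eq_add hWV hβ hαW hαβ, quotientHomologyLength_eq_add hWV hα hβW hβα,
    h.2, zero_add] at hq
  rw [homologyLength_eq_add' hWV hαW hβα, h.1, zero_add] at hW hW'
  rw [homologyLength_eq_add' hWV hβW hαβ, ← hq, ← add_assoc] at hW
  rw [homologyLength_eq_add hWV hβ hαβ]
  -- The image of one connecting map now stands on both sides and has finite length; cancelling it
  -- leaves the two images that make up the remaining homology of `V`.
  exact WithTop.add_right_cancel hW' (hW.trans (zero_add _).symm)

end Herbrand

end Submodule

/-! ### The rigidity argument in terms of matrices -/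

namespace Matrix

section Exactness

variable {S l m n k : Type*} [CommRing S] [Fintype m] [Fintype n]

lemma exists_eq_mul_of_mulVec {P : Matrix l m S} {Q : Matrix m n S}
    (h : ∀ v, P *ᵥ v = 0 → ∃ w, v = Q *ᵥ w) (X : Matrix m k S) (hX : P * X = 0) :
    ∃ Y : Matrix n k S, X = Q * Y := by
  have h' : ∀ j, ∃ w, X.col j = Q *ᵥ w := fun j ↦ h _ (by
    ext i
    exact congrFun (congrFun hX i) j)
  choose w hw using h'
  exact ⟨fun i j ↦ w j i, by ext i j; exact congrFun (hw j) i⟩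

lemma exists_eq_mul_of_vecMul {P : Matrix m l S} {Q : Matrix n m S}
    (h : ∀ v, v ᵥ* P = 0 → ∃ w, v = w ᵥ* Q) (X : Matrix k m S) (hX : X * P = 0) :
    ∃ Y : Matrix k n S, X = Y * Q := by
  have h' : ∀ j, ∃ w, X.row j = w ᵥ* Q := fun j ↦ h _ (by
    ext i
    exact congrFun (congrFun hX j) i)
  choose w hw using h'
  exact ⟨fun i j ↦ w i j, by ext i j; exact congrFun (hw i) j⟩

end Exactness

/-- Data over `S` extracted from a matrix factorization: `A` and `B` form a two-periodic complex
that is exact along with its transpose, and it resolves the image of `u`. -/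
structure IsPeriodicResolution {S : Type*} [CommRing S] {b n : Type*} [Fintype b] [Fintype n]
    (A B : Matrix n n S) (u : Matrix b n S) : Prop where
  mul_eq_zero : A * B = 0
  mul_eq_zero' : B * A = 0
  exact_left : ∀ v, A *ᵥ v = 0 → ∃ w, v = B *ᵥ w
  exact_left' : ∀ v, B *ᵥ v = 0 → ∃ w, v = A *ᵥ w
  exact_right : ∀ v, v ᵥ* A = 0 → ∃ w, v = w ᵥ* B
  exact_right' : ∀ v, v ᵥ* B = 0 → ∃ w, v = w ᵥ* A
  mul_eq_zero_u : u * A = 0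
  exact_u : ∀ v, u *ᵥ v = 0 → ∃ w, v = A *ᵥ w

section Core

variable {S : Type*} [CommRing S] {b n : Type*} [Fintype b] [Fintype n] [DecidableEq b]
  [DecidableEq n] {A B : Matrix n n S} {u : Matrix b n S}

/-- Matrices `w` with `w * u = 0`. -/
def leftKer (k : Type*) (u : Matrix b n S) : Submodule S (Matrix k b S) :=
  LinearMap.ker (mulRightLinearMap k S u)

omit [DecidableEq b] [DecidableEq n] [Fintype n] in
lemma mem_leftKer {k : Type*} {u : Matrix b n S} {w : Matrix k b S} :
    w ∈ leftKer k u ↔ w * u = 0 := Iff.rfl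

omit [DecidableEq b] [DecidableEq n] in
-- With `K = coker A ≅ im B` and `N = coker u`, `hext` says that every map `K → N` extends to `Sᵇ`,
-- which is `Ext¹(N, N) = 0`. A matrix `X` with `A X = 0 = X B` is a map from `ΩK = im A` to `K`,
-- and `X = B U A` says that it extends to `Sⁿ`; so the conclusion is `Ext¹(K, K) = 0`. The
-- transposed exactness, used to produce `Φ`, is `Ext¹(K, S) = 0`.
lemma exists_eq_mul_mul_of_ext_eq_zero (h : IsPeriodicResolution A B u)
    (hext : ∀ (Φ : Matrix b n S) (Z : Matrix n n S), Φ * A = u * Z →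
      ∃ (Ψ : Matrix b b S) (Θ : Matrix n n S), Φ = Ψ * u + u * Θ)
    (X : Matrix n n S) (hA : A * X = 0) (hB : X * B = 0) : ∃ U : Matrix n n S, X = B * U * A := by
  obtain ⟨Z, rfl⟩ := exists_eq_mul_of_mulVec h.exact_left X hA
  obtain ⟨V, hV⟩ := exists_eq_mul_of_mulVec h.exact_left' (Z * B) (by rw [← mul_assoc, hB])
  obtain ⟨Φ, hΦ⟩ := exists_eq_mul_of_vecMul h.exact_right' (u * Z)
    (by rw [Matrix.mul_assoc, hV, ← Matrix.mul_assoc, h.mul_eq_zero_u, Matrix.zero_mul])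
  obtain ⟨Ψ, Θ, rfl⟩ := hext Φ Z hΦ.symm
  obtain ⟨W, hW⟩ := exists_eq_mul_of_mulVec h.exact_u (Z - Θ * A) (by
    rw [Matrix.mul_sub, hΦ, Matrix.add_mul, Matrix.mul_assoc Ψ, h.mul_eq_zero_u, Matrix.mul_zero,
      zero_add, Matrix.mul_assoc, sub_self])
  refine ⟨Θ, ?_⟩
  rw [sub_eq_iff_eq_add.1 hW, Matrix.mul_add, ← Matrix.mul_assoc, h.mul_eq_zero', Matrix.zero_mul,
    zero_add, Matrix.mul_assoc]

omit [DecidableEq b] in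
-- The rows of `leftKer n u` are elements of `N*`, those of `leftKer n A` elements of `K*`, and
-- right multiplication by `u` is the map `(Sᵇ)* → K*` with kernel `N*`. Thus `hθ` is the theta
-- condition, `hfin` says that `Ext¹(N, S)` has finite length, and `hext` is `Ext¹(ΩK, ΩK) = 0`. The
-- conclusion says that the identity of `K` factors through a free module.
lemma exists_eq_mul_mul_self (h : IsPeriodicResolution A B u)
    (hext : ∀ X : Matrix n n S, X * A = 0 → B * X = 0 → ∃ U : Matrix n n S, X = A * U * B)
    (hfin : (LinearMap.range (mulRightLinearMap n S u)).relLength (leftKer n A) ≠ ⊤)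
    (hθ : Submodule.homologyLength (mulLeftLinearMap b S A) (mulLeftLinearMap b S B) (leftKer n u) =
      Submodule.homologyLength (mulLeftLinearMap b S B) (mulLeftLinearMap b S A) (leftKer n u))
    (hθ' : Submodule.homologyLength (mulLeftLinearMap b S B) (mulLeftLinearMap b S A)
      (leftKer n u) ≠ ⊤) : ∃ Y : Matrix n n S, B = B * Y * B := by
  set α := mulLeftLinearMap b S A with hα
  set β := mulLeftLinearMap b S B with hβ
  set α' := mulLeftLinearMap n S A with hα'
  set β' := mulLeftLinearMap n S B with hβ'
  set φ := mulRightLinearMap n S u with hφ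
  -- the coefficient module `Sᵇ` gives exact complexes
  have e1 : Submodule.homologyLength α β ⊤ = 0 := by
    rw [Submodule.homologyLength, Submodule.relLength_eq_zero_iff]
    rintro X ⟨-, hX⟩
    obtain ⟨Y, rfl⟩ := exists_eq_mul_of_mulVec h.exact_left X hX
    exact ⟨Y, trivial, rfl⟩
  have e2 : Submodule.homologyLength β α ⊤ = 0 := by
    rw [Submodule.homologyLength, Submodule.relLength_eq_zero_iff]
    rintro X ⟨-, hX⟩
    obtain ⟨Y, rfl⟩ := exists_eq_mul_of_mulVec h.exact_left' X hX
    exact ⟨Y, trivial, rfl⟩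
  have αβ : ∀ X, α (β X) = 0 := fun X ↦ by
    simp [hα, hβ, ← Matrix.mul_assoc, h.mul_eq_zero]
  have βα : ∀ X, β (α X) = 0 := fun X ↦ by
    simp [hα, hβ, ← Matrix.mul_assoc, h.mul_eq_zero']
  have αβ' : ∀ X, α' (β' X) = 0 := fun X ↦ by
    simp [hα', hβ', ← Matrix.mul_assoc, h.mul_eq_zero]
  have βα' : ∀ X, β' (α' X) = 0 := fun X ↦ by
    simp [hα', hβ', ← Matrix.mul_assoc, h.mul_eq_zero']
  have αW : ∀ C : Matrix n n S, (leftKer n u).map (mulLeftLinearMap b S C) ≤ leftKer n u := by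
    rintro C _ ⟨X, hX, rfl⟩
    change C * X * u = 0
    rw [Matrix.mul_assoc, mem_leftKer.1 hX, Matrix.mul_zero]
  have αV : ∀ C : Matrix n n S, (leftKer n A).map (mulLeftLinearMap n S C) ≤ leftKer n A := by
    rintro C _ ⟨X, hX, rfl⟩
    change C * X * A = 0
    rw [Matrix.mul_assoc, mem_leftKer.1 hX, Matrix.mul_zero]
  have q1 := Submodule.quotientHomologyLength_eq_of_homologyLength_eq_zero (α := α) (β := β)
    (W := leftKer n u) (V := ⊤) le_top le_top le_top (αW A) (by rintro _ ⟨X, -, rfl⟩; exact αβ X)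
    (by rintro _ ⟨X, -, rfl⟩; exact βα X) e1 e2
  have q2 := Submodule.quotientHomologyLength_eq_of_homologyLength_eq_zero (α := β) (β := α)
    (W := leftKer n u) (V := ⊤) le_top le_top le_top (αW B) (by rintro _ ⟨X, -, rfl⟩; exact βα X)
    (by rintro _ ⟨X, -, rfl⟩; exact αβ X) e2 e1
  -- transport to the image of `φ`
  have tr : ∀ C D : Matrix n n S, Submodule.quotientHomologyLength (mulLeftLinearMap b S C)
      (mulLeftLinearMap b S D) (leftKer n u) ⊤ = Submodule.homologyLength (mulLeftLinearMap n S C)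
      (mulLeftLinearMap n S D) (LinearMap.range φ) := by
    intro C D
    have comm : ∀ C : Matrix n n S, φ ∘ₗ mulLeftLinearMap b S C = mulLeftLinearMap n S C ∘ₗ φ := by
      intro C; ext1 X; exact Matrix.mul_assoc _ _ _
    have hk : leftKer n u = LinearMap.ker φ := rfl
    have h1 : (⊤ : Submodule S (Matrix n b S)).map (mulLeftLinearMap b S D) ⊔ leftKer n u =
        (((LinearMap.range φ).map (mulLeftLinearMap n S D))).comap φ := by
      rw [LinearMap.range_eq_map, ← Submodule.map_comp, ← comm, Submodule.map_comp,
        Submodule.comap_map_eq, hk]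
    have h2 : ((⊤ : Submodule S (Matrix n b S)) ⊓ (leftKer n u).comap (mulLeftLinearMap b S C)).map
        φ = LinearMap.range φ ⊓ LinearMap.ker (mulLeftLinearMap n S C) := by
      rw [top_inf_eq, hk, ← LinearMap.ker_comp, comm, LinearMap.ker_comp, Submodule.map_comap_eq]
    rw [Submodule.quotientHomologyLength, h1, Submodule.relLength_comap, h2]
    rfl
  rw [tr] at q1 q2
  have hWV : LinearMap.range φ ≤ leftKer n A := by
    rintro _ ⟨X, rfl⟩
    change X * u * A = 0
    rw [Matrix.mul_assoc, h.mul_eq_zero_u, Matrix.mul_zero]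
  have αW' : ∀ C : Matrix n n S,
      (LinearMap.range φ).map (mulLeftLinearMap n S C) ≤ LinearMap.range φ := by
    rintro C _ ⟨_, ⟨X, rfl⟩, rfl⟩
    exact ⟨C * X, Matrix.mul_assoc _ _ _⟩
  -- Cycles in this parity are the `X` with `X A = 0 = B X`. Since `U B` has rows in `K*`, the form
  -- `A U B` given by `hext` is a boundary.
  have e3 : Submodule.homologyLength β' α' (leftKer n A) = 0 := by
    rw [Submodule.homologyLength, Submodule.relLength_eq_zero_iff]
    rintro X ⟨hX, hX'⟩
    obtain ⟨U, rfl⟩ := hext X hX hX'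
    refine ⟨U * B, ?_, (Matrix.mul_assoc _ _ _).symm⟩
    change U * B * A = 0
    rw [Matrix.mul_assoc, h.mul_eq_zero', Matrix.mul_zero]
  have e4 := Submodule.homologyLength_eq_zero_of_finite_quotient (α := α') (β := β') hWV (αV A)
    (αV B) (αW' A) (αW' B) (by rintro _ ⟨X, -, rfl⟩; exact αβ' X)
    (by rintro _ ⟨X, -, rfl⟩; exact βα' X) hfin (by rw [q1, q2, hθ])
    (by rw [q2, hθ]; exact hθ') e3
  rw [Submodule.homologyLength, Submodule.relLength_eq_zero_iff] at e4
  -- `B` is the cycle that represents the identity of `K`, under `coker A ≅ im B`.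
  obtain ⟨X, hX, hX'⟩ := e4 (x := B) ⟨h.mul_eq_zero', h.mul_eq_zero⟩
  obtain ⟨Y, rfl⟩ := exists_eq_mul_of_vecMul h.exact_right X hX
  exact ⟨Y, by rw [Matrix.mul_assoc]; exact hX'.symm⟩

/-- `1 - e` reduces to the identity over the residue field, so it is invertible, and it annihilates
`e`. -/
lemma eq_zero_of_isIdempotentElem [IsLocalRing S] (e : Matrix n n S) (he : e * e = e)
    (hm : ∀ i j, e i j ∈ maximalIdeal S) : e = 0 := by
  have hu : IsUnit (1 - e) := by
    rw [Matrix.isUnit_iff_isUnit_det]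
    have h1 : (residue S) (1 - e).det = 1 := by
      rw [RingHom.map_det]
      have : (residue S).mapMatrix (1 - e) = 1 := by
        rw [map_sub, map_one, sub_eq_self]
        ext i j
        exact (residue_eq_zero_iff _).2 (hm i j)
      rw [this, det_one]
    by_contra hc
    have := (residue_eq_zero_iff _).2 ((mem_maximalIdeal _).2 hc)
    exact one_ne_zero (h1.symm.trans this)
  have : (1 - e) * e = 0 := by rw [sub_mul, one_mul, he, sub_self]
  exact hu.mul_right_eq_zero.1 this

/-- From `B = B Y B`, the matrix `Y B` is an idempotent through which `u` factors. Extending maps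
from `K` to `Sᵇ` a second time shows that its entries lie in the maximal ideal, so it vanishes. No
minimality of `A` or `B` is needed, only that of `u`. -/
theorem eq_zero_of_ext_eq_zero_of_theta_eq_zero [IsLocalRing S] (h : IsPeriodicResolution A B u)
    (hext : ∀ (Φ : Matrix b n S) (Z : Matrix n n S), Φ * A = u * Z →
      ∃ (Ψ : Matrix b b S) (Θ : Matrix n n S), Φ = Ψ * u + u * Θ)
    (hshift : (∀ X : Matrix n n S, A * X = 0 → X * B = 0 → ∃ U : Matrix n n S, X = B * U * A) →
      ∀ X : Matrix n n S, X * A = 0 → B * X = 0 → ∃ U : Matrix n n S, X = A * U * B)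
    (hfin : (LinearMap.range (mulRightLinearMap n S u)).relLength (leftKer n A) ≠ ⊤)
    (hθ : Submodule.homologyLength (mulLeftLinearMap b S A) (mulLeftLinearMap b S B) (leftKer n u) =
      Submodule.homologyLength (mulLeftLinearMap b S B) (mulLeftLinearMap b S A) (leftKer n u))
    (hθ' : Submodule.homologyLength (mulLeftLinearMap b S B) (mulLeftLinearMap b S A)
      (leftKer n u) ≠ ⊤) (hu : ∀ i j, u i j ∈ maximalIdeal S) : u = 0 := by
  obtain ⟨Y, hY⟩ := exists_eq_mul_mul_self h
    (hshift (exists_eq_mul_mul_of_ext_eq_zero h hext)) hfin hθ hθ'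
  obtain ⟨V, hV⟩ := exists_eq_mul_of_mulVec h.exact_left' (1 - Y * B)
    (by rw [Matrix.mul_sub, ← Matrix.mul_assoc, ← hY, Matrix.mul_one, sub_self])
  have huY : u = u * (Y * B) := by
    have : u * (1 - Y * B) = 0 := by rw [hV, ← Matrix.mul_assoc, h.mul_eq_zero_u, Matrix.zero_mul]
    rwa [Matrix.mul_sub, Matrix.mul_one, sub_eq_zero] at this
  -- The index `i` only supplies a row of `Sᵇ` in which to place a row of `Y B`; if `b` is empty, `u
  -- = 0` holds vacuously.
  suffices hYB : ∀ i : b, Y * B = 0 by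
    ext i j
    rw [huY, hYB i, Matrix.mul_zero]
  intro i
  refine eq_zero_of_isIdempotentElem _ (by
    -- Row `j` of `Y B` kills `A`, hence defines a map `K → S`. Put in row `i` of a map to `Sᵇ`, it
    -- has the form `Ψ u + u Θ`, whose entries are in the maximal ideal.
    rw [Matrix.mul_assoc, ← Matrix.mul_assoc B, ← hY]) fun j k ↦ ?_
  obtain ⟨Ψ, Θ, hΨ⟩ := hext (Matrix.single i j (1 : S) * (Y * B)) 0 (by
    rw [Matrix.mul_zero, Matrix.mul_assoc, Matrix.mul_assoc, h.mul_eq_zero', Matrix.mul_zero,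
      Matrix.mul_zero])
  have h1 : (Y * B) j k = (Ψ * u + u * Θ) i k := by
    rw [← hΨ, Matrix.single_mul_apply_same, one_mul]
  rw [h1, Matrix.add_apply, Matrix.mul_apply, Matrix.mul_apply]
  exact Ideal.add_mem _ (Ideal.sum_mem _ fun l _ ↦ Ideal.mul_mem_left _ _ (hu _ _))
    (Ideal.sum_mem _ fun l _ ↦ Ideal.mul_mem_right _ _ (hu _ _))

end Core

/-! ### Reduction of a matrix factorization modulo `f` -/

section Factorization

variable {T S : Type*} [CommRing T] [CommRing S] {π : T →+* S} (hπ : Function.Surjective π)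
  {f : T} (hker : RingHom.ker π = Ideal.span {f}) (hf : f ∈ nonZeroDivisors T)
  {n : Type*} [Fintype n] [DecidableEq n] {A B : Matrix n n T} (hAB : A * B = f • 1)

include hπ in
omit [Fintype n] [DecidableEq n] in
lemma exists_map_eq_of_surjective {m : Type*} (X : Matrix m n S) :
    ∃ Y : Matrix m n T, Y.map π = X := by
  choose g hg using hπ
  exact ⟨X.map g, by ext i j; exact hg _⟩

include hker in
omit [Fintype n] [DecidableEq n] in
lemma exists_eq_smul_of_map_eq_zero {m : Type*} (X : Matrix m n T) (hX : X.map π = 0) :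
    ∃ Y : Matrix m n T, X = f • Y := by
  have : ∀ i j, ∃ y, X i j = f * y := fun i j ↦ by
    have : X i j ∈ RingHom.ker π := congrFun (congrFun hX i) j
    rw [hker, Ideal.mem_span_singleton] at this
    exact this
  choose Y hY using this
  exact ⟨Y, by ext i j; exact hY i j⟩

include hf in
omit [Fintype n] [DecidableEq n] in
lemma smul_left_cancel_of_mem_nonZeroDivisors {m : Type*} {X Y : Matrix m n T}
    (h : f • X = f • Y) : X = Y := by
  ext i j
  have := congrFun (congrFun h i) j
  simp only [Matrix.smul_apply, smul_eq_mul] at this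
  exact (mul_cancel_left_mem_nonZeroDivisors hf).1 this

include hker in
lemma map_mul_map_eq_zero (hAB : A * B = f • 1) : A.map π * B.map π = 0 := by
  rw [← Matrix.map_mul, hAB]
  have : π f = 0 := by
    rw [← RingHom.mem_ker, hker]; exact Ideal.mem_span_singleton_self f
  ext i j
  simp [this]

include hπ hker hf in
-- Lift `X` to `T`: then `A X = f Y`, and multiplying by `B` gives `f X = f B Y`, where `f` cancels.
lemma exists_eq_map_mul (hBA : B * A = f • 1) {k : Type*} (X : Matrix n k S)
    (hX : A.map π * X = 0) : ∃ Y : Matrix n k S, X = B.map π * Y := by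
  obtain ⟨X, rfl⟩ := exists_map_eq_of_surjective hπ X
  rw [← Matrix.map_mul] at hX
  obtain ⟨Y, hY⟩ := exists_eq_smul_of_map_eq_zero hker _ hX
  refine ⟨Y.map π, ?_⟩
  rw [← Matrix.map_mul]
  congr 1
  refine smul_left_cancel_of_mem_nonZeroDivisors hf ?_
  rw [← Matrix.mul_smul, ← hY, ← Matrix.mul_assoc, hBA, Matrix.smul_mul, Matrix.one_mul]

include hπ hker hf in
lemma exists_eq_mul_map (hAB : A * B = f • 1) {k : Type*} (X : Matrix k n S)
    (hX : X * A.map π = 0) : ∃ Y : Matrix k n S, X = Y * B.map π := by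
  obtain ⟨X, rfl⟩ := exists_map_eq_of_surjective hπ X
  rw [← Matrix.map_mul] at hX
  obtain ⟨Y, hY⟩ := exists_eq_smul_of_map_eq_zero hker _ hX
  refine ⟨Y.map π, ?_⟩
  rw [← Matrix.map_mul]
  congr 1
  refine smul_left_cancel_of_mem_nonZeroDivisors hf ?_
  rw [← Matrix.smul_mul, ← hY, Matrix.mul_assoc, hAB, Matrix.mul_smul, Matrix.mul_one]

include hπ hker hf in
lemma isPeriodicResolution_map (hAB : A * B = f • 1) (hBA : B * A = f • 1) {b : Type*} [Fintype b]
    (u : Matrix b n S) (huA : u * A.map π = 0)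
    (hu : ∀ v, u *ᵥ v = 0 → ∃ w, v = A.map π *ᵥ w) :
    IsPeriodicResolution (A.map π) (B.map π) u where
  mul_eq_zero := map_mul_map_eq_zero hker hAB
  mul_eq_zero' := map_mul_map_eq_zero hker hBA
  exact_left v hv := by
    obtain ⟨Y, hY⟩ := exists_eq_map_mul hπ hker hf hBA (replicateCol Unit v)
      (by rw [← replicateCol_mulVec, hv, replicateCol_zero])
    exact ⟨fun i ↦ Y i (), by ext i; exact congrFun (congrFun hY i) ()⟩
  exact_left' v hv := by
    obtain ⟨Y, hY⟩ := exists_eq_map_mul hπ hker hf hAB (replicateCol Unit v)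
      (by rw [← replicateCol_mulVec, hv, replicateCol_zero])
    exact ⟨fun i ↦ Y i (), by ext i; exact congrFun (congrFun hY i) ()⟩
  exact_right v hv := by
    obtain ⟨Y, hY⟩ := exists_eq_mul_map hπ hker hf hAB (replicateRow Unit v)
      (by rw [← replicateRow_vecMul, hv, replicateRow_zero])
    exact ⟨Y (), by ext i; exact congrFun (congrFun hY ()) i⟩
  exact_right' v hv := by
    obtain ⟨Y, hY⟩ := exists_eq_mul_map hπ hker hf hBA (replicateRow Unit v)
      (by rw [← replicateRow_vecMul, hv, replicateRow_zero])
    exact ⟨Y (), by ext i; exact congrFun (congrFun hY ()) i⟩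
  mul_eq_zero_u := huA
  exact_u := hu

include hπ hker hf in
/-- Rotation by one step in both variables of a morphism of matrix factorizations. -/
lemma exists_eq_mul_mul_of_shift (hAB : A * B = f • 1)
    (h : ∀ X : Matrix n n S, A.map π * X = 0 → X * B.map π = 0 → ∃ U : Matrix n n S, X = B.map π * U * A.map π)
    (X : Matrix n n S) (hA : X * A.map π = 0) (hB : B.map π * X = 0) :
    ∃ U : Matrix n n S, X = A.map π * U * B.map π := by
  obtain ⟨Y, rfl⟩ := exists_eq_mul_map hπ hker hf hAB X hA
  obtain ⟨Y, rfl⟩ := exists_map_eq_of_surjective hπ Y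
  obtain ⟨U, hU⟩ := h (B.map π * Y.map π)
    (by rw [← Matrix.mul_assoc, map_mul_map_eq_zero hker hAB, Matrix.zero_mul])
    (by rw [Matrix.mul_assoc, hB])
  obtain ⟨U, rfl⟩ := exists_map_eq_of_surjective hπ U
  simp only [← Matrix.map_mul] at hU
  obtain ⟨V, hV⟩ := exists_eq_smul_of_map_eq_zero hker (B * Y - B * U * A)
    (by rw [Matrix.map_sub π (map_sub π), hU, sub_self])
  -- Multiply `B Y - B U A = f V` by `A` and cancel `f`. Then `Y B = U (A B) + A V B`, and the first
  -- term vanishes modulo `f`.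
  have hY : Y = U * A + A * V := by
    refine smul_left_cancel_of_mem_nonZeroDivisors hf ?_
    have := congrArg (A * ·) hV
    simp only [Matrix.mul_sub, ← Matrix.mul_assoc, hAB, Matrix.smul_mul, Matrix.one_mul,
      Matrix.mul_smul] at this
    rw [smul_add, ← this, add_sub_cancel]
  have hz : (U * (A * B)).map π = 0 := by
    rw [Matrix.map_mul, Matrix.map_mul, map_mul_map_eq_zero hker hAB, Matrix.mul_zero]
  refine ⟨V.map π, ?_⟩
  rw [hY, ← Matrix.map_mul, ← Matrix.map_mul, ← Matrix.map_mul, Matrix.add_mul,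
    Matrix.map_add π (map_add π), Matrix.mul_assoc U, hz, zero_add]

end Factorization

end Matrix

/-! ### Regular local rings: cutting by a parameter, integrality -/

namespace IsRegularLocalRing

variable {T : Type*} [CommRing T] [IsRegularLocalRing T]

/-- Prime avoidance tolerates the one non-prime ideal `𝔪²`. If `𝔪 ⊆ 𝔪²`, Nakayama gives `𝔪 = 0`; if
`𝔪` lies in a minimal prime, its height is 0. Both contradict positive dimension. -/
lemma exists_mem_notMem_sq (h : 0 < ringKrullDim T) :
    ∃ x ∈ maximalIdeal T, x ∉ maximalIdeal T ^ 2 ∧ ∀ p ∈ minimalPrimes T, x ∉ p := by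
  by_contra! hc
  have hsub : (maximalIdeal T : Set T) ⊆ ⋃ I ∈ insert (maximalIdeal T ^ 2) (minimalPrimes T),
      (I : Set T) := by
    intro x hx
    by_cases hx2 : x ∈ maximalIdeal T ^ 2
    · exact Set.mem_biUnion (Set.mem_insert _ _) hx2
    · obtain ⟨p, hp, hxp⟩ := hc x hx hx2
      exact Set.mem_biUnion (Set.mem_insert_of_mem _ hp) hxp
  have hfin : (insert (maximalIdeal T ^ 2) (minimalPrimes T)).Finite :=
    (minimalPrimes.finite_of_isNoetherianRing T).insert _
  obtain ⟨I, hI, hle⟩ := (Ideal.subset_union_prime_finite hfin (f := id) (maximalIdeal T ^ 2)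
    (maximalIdeal T ^ 2) (fun J hJ h1 _ ↦ (hJ.resolve_left h1).1.1)).1 hsub
  rcases hI with rfl | hI
  · have hbot : maximalIdeal T = ⊥ := by
      refine Submodule.eq_bot_of_le_smul_of_le_jacobson_bot (maximalIdeal T) (maximalIdeal T)
        (maximalIdeal T).fg_of_isNoetherianRing ?_ (maximalIdeal_le_jacobson _)
      rw [smul_eq_mul, ← pow_two]; exact hle
    have := spanFinrank_maximalIdeal (R := T)
    rw [hbot, Submodule.spanFinrank_bot] at this
    exact h.ne this
  · have hp : I.IsPrime := hI.1.1
    have hIm : I = maximalIdeal T := le_antisymm (le_maximalIdeal hp.ne_top) hle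
    have h0 : (maximalIdeal T).height = 0 := by
      rw [← hIm, Ideal.height_eq_zero_iff]; exact hI
    rw [← maximalIdeal_height_eq_ringKrullDim, h0] at h
    exact lt_irrefl _ h

/-- Since `x ∉ 𝔪²`, some coefficient of `x` in a minimal generating set is a unit, so that generator
becomes redundant modulo `x`. -/
lemma spanFinrank_maximalIdeal_quotient_lt {x : T} (hx : x ∈ maximalIdeal T)
    (hx2 : x ∉ maximalIdeal T ^ 2) [IsLocalRing (T ⧸ Ideal.span {x})] :
    (maximalIdeal (T ⧸ Ideal.span {x})).spanFinrank < (maximalIdeal T).spanFinrank := by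
  classical
  obtain ⟨s, hs, hspan⟩ :=
    Submodule.FG.exists_span_finset_card_eq_spanFinrank (maximalIdeal T).fg_of_isNoetherianRing
  rw [← hspan] at hx
  obtain ⟨a, ha⟩ := Submodule.mem_span_finset.1 hx
  obtain ⟨i, his, hai⟩ : ∃ i ∈ s, IsUnit (a i) := by
    by_contra! hc
    apply hx2
    rw [← ha.2, pow_two]
    refine Ideal.sum_mem _ fun i hi ↦ Ideal.mul_mem_mul ((mem_maximalIdeal _).2 (hc i hi)) ?_
    rw [← hspan]; exact Submodule.subset_span hi
  have hmap : maximalIdeal (T ⧸ Ideal.span {x}) =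
      Ideal.span (((s.erase i).image (Ideal.Quotient.mk (Ideal.span {x})) : Finset _) : Set _) := by
    rw [← map_maximalIdeal_of_surjective _ (Ideal.Quotient.mk_surjective (I := Ideal.span {x})),
      Finset.coe_image, ← Ideal.map_span, ← hspan]
    refine le_antisymm ?_ (Ideal.map_mono (Ideal.span_mono (Finset.erase_subset _ _)))
    rw [Ideal.map_span, Ideal.span_le]
    rintro _ ⟨j, hj, rfl⟩
    by_cases hji : j = i
    · subst hji
      have hsum : a j * j + ∑ k ∈ s.erase j, a k • k = x :=
        (Finset.add_sum_erase s (fun k ↦ a k • k) hj).trans ha.2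
      have hx0 : Ideal.Quotient.mk (Ideal.span {x}) (a j * j + ∑ k ∈ s.erase j, a k • k) = 0 := by
        rw [hsum]; exact Ideal.Quotient.eq_zero_iff_mem.2 (Ideal.mem_span_singleton_self x)
      rw [map_add, map_mul] at hx0
      obtain ⟨c, hc⟩ := hai.map (Ideal.Quotient.mk (Ideal.span {x}))
      rw [← hc] at hx0
      have : Ideal.Quotient.mk (Ideal.span {x}) j = -(↑c⁻¹ * Ideal.Quotient.mk (Ideal.span {x})
          (∑ k ∈ s.erase j, a k • k)) := by
        rw [← sub_eq_zero, sub_neg_eq_add, ← Units.mul_right_eq_zero c, mul_add,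
          Units.mul_inv_cancel_left, hx0]
      rw [SetLike.mem_coe, this]
      refine Ideal.neg_mem_iff _ |>.2 (Ideal.mul_mem_left _ _ (Ideal.mem_map_of_mem _ ?_))
      exact Ideal.sum_mem _ fun k hk ↦ Ideal.mul_mem_left _ _ (Ideal.subset_span hk)
    · exact Ideal.mem_map_of_mem _ (Ideal.subset_span (Finset.mem_erase.2 ⟨hji, hj⟩))
  rw [hmap]
  refine (Submodule.spanFinrank_span_le_ncard_of_finite (Finset.finite_toSet _)).trans_lt ?_
  rw [Set.ncard_coe_finset, ← hs]
  exact Finset.card_image_le.trans_lt (Finset.card_erase_lt_of_mem his)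

/-- The embedding dimension drops by at least one and the Krull dimension by at most one. As the
former bounds the latter, and the two agree for `T`, both drop by exactly one. -/
lemma quotient_span_singleton {x : T} (hx : x ∈ maximalIdeal T) (hx2 : x ∉ maximalIdeal T ^ 2) :
    IsRegularLocalRing (T ⧸ Ideal.span {x}) ∧
      ringKrullDim (T ⧸ Ideal.span {x}) + 1 = ringKrullDim T := by
  have hnt : Nontrivial (T ⧸ Ideal.span {x}) :=
    Ideal.Quotient.nontrivial_iff.2
      (ne_top_of_le_ne_top (Ideal.IsPrime.ne_top inferInstance)
        ((Ideal.span_singleton_le_iff_mem _).2 hx))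
  have hloc : IsLocalRing (T ⧸ Ideal.span {x}) :=
    IsLocalRing.of_surjective' (Ideal.Quotient.mk (Ideal.span {x})) Ideal.Quotient.mk_surjective
  have h1 := spanFinrank_maximalIdeal_quotient_lt hx hx2
  have h2 := ringKrullDim_le_spanFinrank_maximalIdeal (T ⧸ Ideal.span {x})
  have h3 : ringKrullDim T ≤ ringKrullDim (T ⧸ Ideal.span {x}) + 1 := by
    have := ringKrullDim_le_ringKrullDim_quotient_add_spanFinrank (Ideal.span {x})
      ((Ideal.span_singleton_le_iff_mem _).2 (by rwa [ringJacobson_eq_maximalIdeal]))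
    refine this.trans ?_
    gcongr
    have := Submodule.spanFinrank_span_le_ncard_of_finite (R := T) (Set.finite_singleton x)
    rw [Set.ncard_singleton] at this
    exact_mod_cast this
  have h4 := spanFinrank_maximalIdeal (R := T)
  obtain ⟨k, hk⟩ : ∃ k : ℕ, ringKrullDim (T ⧸ Ideal.span {x}) = k := by
    obtain ⟨k, hk⟩ := (WithBot.ne_bot_iff_exists (x := ringKrullDim (T ⧸ Ideal.span {x}))).1
      ringKrullDim_ne_bot
    rw [← hk] at h2 ⊢
    obtain ⟨j, rfl⟩ := ENat.ne_top_iff_exists.1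
      (ne_top_of_le_ne_top (ENat.natCast_ne_top _) (WithBot.coe_le_coe.1 h2))
    exact ⟨j, rfl⟩
  rw [hk] at h2 h3 ⊢
  rw [← h4] at h3 ⊢
  norm_cast at h2 h3 ⊢
  refine ⟨of_spanFinrank_maximalIdeal_le _ ?_, by omega⟩
  rw [hk]
  norm_cast
  omega

variable (T)

lemma exists_ringKrullDim_eq : ∃ d : ℕ, ringKrullDim T = d :=
  ⟨_, spanFinrank_maximalIdeal.symm⟩

lemma isField_of_ringKrullDim_eq_zero (h : ringKrullDim T = 0) : IsField T := by
  rw [isField_iff_maximalIdeal_eq, ← Submodule.spanFinrank_eq_zero_iff_eq_bot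
    (maximalIdeal T).fg_of_isNoetherianRing]
  have := spanFinrank_maximalIdeal (R := T)
  rw [h] at this
  exact_mod_cast this

/-- By induction `(x)` is prime. A minimal prime `q ⊆ (x)` does not contain `x`, so `q = x q`, and
Nakayama gives `q = 0`. -/
instance isDomain : IsDomain T := by
  obtain ⟨d, hd⟩ := exists_ringKrullDim_eq T
  induction d generalizing T with
  | zero => exact (isField_of_ringKrullDim_eq_zero T hd).isDomain
  | succ d ih =>
    obtain ⟨x, hx, hx2, hp⟩ := exists_mem_notMem_sq (T := T) (by rw [hd]; exact_mod_cast d.succ_pos)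
    obtain ⟨h1, h2⟩ := quotient_span_singleton hx hx2
    have hdq : ringKrullDim (T ⧸ Ideal.span {x}) = d := by
      rw [hd, Nat.cast_add, Nat.cast_one] at h2
      exact ENat.WithBot.add_natCast_cancel (c := 1) |>.1 (by simpa using h2)
    have := ih (T ⧸ Ideal.span {x}) hdq
    have hprime : (Ideal.span {x}).IsPrime := (Ideal.Quotient.isDomain_iff_prime _).1 this
    obtain ⟨q, hq, hqx⟩ := Ideal.exists_minimalPrimes_le (bot_le (a := Ideal.span {x}))
    have hxq := hp q hq
    have hqp : q.IsPrime := hq.1.1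
    have hbot : q = ⊥ := by
      refine Submodule.eq_bot_of_le_smul_of_le_jacobson_bot (maximalIdeal T) q
        q.fg_of_isNoetherianRing ?_ (maximalIdeal_le_jacobson _)
      intro y hy
      obtain ⟨z, rfl⟩ := Ideal.mem_span_singleton.1 (hqx hy)
      exact Submodule.smul_mem_smul hx ((hqp.mem_or_mem hy).resolve_left hxq)
    rw [hbot] at hqp
    exact IsDomain.of_bot_isPrime T

end IsRegularLocalRing

/-! ### Global dimension and regular sequences of regular local rings -/

section GlobalDimension

open ModuleCat

/-- A short exact sequence of modules as a short exact sequence in `ModuleCat`. -/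
lemma ModuleCat.shortExact_of_exact {R : Type u} [CommRing R] {M₁ M₂ M₃ : Type v}
    [AddCommGroup M₁] [AddCommGroup M₂] [AddCommGroup M₃] [Module R M₁] [Module R M₂] [Module R M₃]
    {f : M₁ →ₗ[R] M₂} {g : M₂ →ₗ[R] M₃} (hf : Function.Injective f) (hfg : Function.Exact f g)
    (hg : Function.Surjective g) :
    (ModuleCat.shortComplexOfCompEqZero f g hfg.linearMap_comp_eq_zero).ShortExact where
  exact := ModuleCat.shortComplex_exact _ hfg
  mono_f := (ModuleCat.mono_iff_injective _).2 hf
  epi_g := (ModuleCat.epi_iff_surjective _).2 hg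

lemma ModuleCat.hasProjectiveDimensionLT_ker {R : Type u} [CommRing R] {M N : Type u}
    [AddCommGroup M] [AddCommGroup N] [Module R M] [Module R N] (f : M →ₗ[R] N)
    (hf : Function.Surjective f) (n : ℕ) (hM : HasProjectiveDimensionLT (ModuleCat.of R M) n)
    (hN : HasProjectiveDimensionLT (ModuleCat.of R N) (n + 1)) :
    HasProjectiveDimensionLT (ModuleCat.of R (LinearMap.ker f)) n :=
  (LinearMap.shortExact_shortComplexKer hf).hasProjectiveDimensionLT_X₁ n hM hN

lemma ModuleCat.hasProjectiveDimensionLT_one_of_free {R : Type u} [CommRing R] {M : Type u}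
    [AddCommGroup M] [Module R M] [Module.Free R M] :
    HasProjectiveDimensionLT (ModuleCat.of R M) 1 := by
  rw [← projective_iff_hasProjectiveDimensionLT_one, ← IsProjective.iff_projective]
  infer_instance

lemma ModuleCat.free_of_hasProjectiveDimensionLT_one {R : Type u} [CommRing R] [IsLocalRing R]
    {M : Type u} [AddCommGroup M] [Module R M] [Module.Finite R M]
    (h : HasProjectiveDimensionLT (ModuleCat.of R M) 1) : Module.Free R M := by
  rw [← projective_iff_hasProjectiveDimensionLT_one, ← IsProjective.iff_projective] at h
  exact Module.free_of_flat_of_isLocalRing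

open scoped Pointwise in
-- Induction on syzygies, which remain `x`-regular and whose formation commutes with reduction
-- modulo `x`. The base case is that `M` is free as soon as `M/xM` is free over `R/x`.
theorem hasProjectiveDimensionLT_of_quotSMulTop {R : Type u} [CommRing R] [IsLocalRing R]
    [IsNoetherianRing R] {x : R} (hx : x ∈ maximalIdeal R) (hxR : IsSMulRegular R x) (n : ℕ)
    (M : Type u) [AddCommGroup M] [Module R M] [Module.Finite R M] (hxM : IsSMulRegular M x)
    (h : HasProjectiveDimensionLT (ModuleCat.of (R ⧸ Ideal.span {x}) (QuotSMulTop x M)) (n + 1)) :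
    HasProjectiveDimensionLT (ModuleCat.of R M) (n + 1) := by
  have hnt : Nontrivial (R ⧸ Ideal.span {x}) :=
    Ideal.Quotient.nontrivial_iff.2
      (ne_top_of_le_ne_top (Ideal.IsPrime.ne_top inferInstance)
        ((Ideal.span_singleton_le_iff_mem _).2 hx))
  have hloc : IsLocalRing (R ⧸ Ideal.span {x}) :=
    IsLocalRing.of_surjective' (Ideal.Quotient.mk (Ideal.span {x})) Ideal.Quotient.mk_surjective
  have hfin : ∀ (M : Type u) [AddCommGroup M] [Module R M] [Module.Finite R M],
      Module.Finite (R ⧸ Ideal.span {x}) (QuotSMulTop x M) := fun M _ _ _ ↦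
    Module.Finite.of_restrictScalars_finite R _ _
  induction n generalizing M with
  | zero =>
    have := hfin M
    have hfree := ModuleCat.free_of_hasProjectiveDimensionLT_one h
    have : Module.FinitePresentation R M := Module.finitePresentation_of_finite R M
    have := (Module.free_quotSMulTop_iff_free R M (maximalIdeal_le_jacobson ⊥ hx) hxM).1 hfree
    exact ModuleCat.hasProjectiveDimensionLT_one_of_free
  | succ n ih =>
    obtain ⟨k, g, hg⟩ := Module.Finite.exists_fin' R M
    have hS := LinearMap.shortExact_shortComplexKer hg
    refine hS.hasProjectiveDimensionLT_X₃ (n + 1) ?_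
      (@hasProjectiveDimensionLT_of_ge _ _ _ _ 1 (n + 2) (by omega)
        (ModuleCat.hasProjectiveDimensionLT_one_of_free (M := Fin k → R)))
    have hxF : IsSMulRegular (Fin k → R) x := fun a b hab ↦ funext fun i ↦ hxR (congrFun hab i)
    refine ih (LinearMap.ker g) (hxF.submodule _ _) ?_
    let i' := (QuotSMulTop.map x (LinearMap.ker g).subtype).extendScalarsOfSurjective
      (S := R ⧸ Ideal.span {x}) Ideal.Quotient.mk_surjective
    let g' := (QuotSMulTop.map x g).extendScalarsOfSurjective
      (S := R ⧸ Ideal.span {x}) Ideal.Quotient.mk_surjective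
    -- Injectivity modulo `x` is where regularity of `x` on `M` enters: if `x z` lies in the kernel
    -- of `g`, so does `z`.
    have hi' : Function.Injective i' := by
      rw [injective_iff_map_eq_zero]
      intro y hy
      obtain ⟨y, rfl⟩ := Submodule.Quotient.mk_surjective _ y
      have hy' : (y : Fin k → R) ∈ x • (⊤ : Submodule R (Fin k → R)) :=
        (Submodule.Quotient.mk_eq_zero _).1 hy
      obtain ⟨z, -, hz⟩ := (Submodule.mem_smul_pointwise_iff_exists _ _ _).1 hy'
      refine (Submodule.Quotient.mk_eq_zero _).2
        ((Submodule.mem_smul_pointwise_iff_exists _ _ _).2 ⟨⟨z, ?_⟩, trivial, Subtype.ext hz⟩)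
      have : x • g z = 0 := by rw [← map_smul, hz]; exact y.2
      exact hxM.right_eq_zero_of_smul this
    have hex : Function.Exact i' g' :=
      QuotSMulTop.map_exact x (LinearMap.exact_subtype_ker_map g) hg
    have hg' : Function.Surjective g' := QuotSMulTop.map_surjective x hg
    exact (ModuleCat.shortExact_of_exact hi' hex hg').hasProjectiveDimensionLT_X₁ (n + 1)
      (@hasProjectiveDimensionLT_of_ge _ _ _ _ 1 (n + 1) (by omega)
        (ModuleCat.hasProjectiveDimensionLT_one_of_free
          (M := QuotSMulTop x (Fin k → R)))) h

/-- A regular local ring of dimension `d` has global dimension at most `d`. -/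
theorem IsRegularLocalRing.hasProjectiveDimensionLE (d : ℕ) (T : Type u) [CommRing T]
    [IsRegularLocalRing T] (hd : ringKrullDim T = d) (M : Type u) [AddCommGroup M] [Module T M]
    [Module.Finite T M] : HasProjectiveDimensionLT (ModuleCat.of T M) (d + 1) := by
  induction d generalizing T M with
  | zero =>
    let F : Field T := @IsField.toField T _ (isField_of_ringKrullDim_eq_zero T hd)
    have : Module.Free T M := @Module.Free.of_divisionRing T M F.toDivisionRing _ _
    exact ModuleCat.hasProjectiveDimensionLT_one_of_free
  | succ d ih =>
    obtain ⟨x, hx, hx2, hp⟩ := exists_mem_notMem_sq (T := T) (by rw [hd]; exact_mod_cast d.succ_pos)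
    obtain ⟨h1, h2⟩ := quotient_span_singleton hx hx2
    have hdq : ringKrullDim (T ⧸ Ideal.span {x}) = d := by
      rw [hd, Nat.cast_add, Nat.cast_one] at h2
      exact ENat.WithBot.add_natCast_cancel (c := 1) |>.1 (by simpa using h2)
    have hx0 : x ≠ 0 := by rintro rfl; exact hx2 (Ideal.zero_mem _)
    have hxT : IsSMulRegular T x := fun a b hab ↦ mul_left_cancel₀ hx0 hab
    obtain ⟨k, g, hg⟩ := Module.Finite.exists_fin' T M
    -- `x` may be a zero divisor on `M`, but it is regular on the first syzygy, a submodule of a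
    -- free module. The syzygy thus costs one dimension and the reduction modulo `x` none.
    refine (LinearMap.shortExact_shortComplexKer hg).hasProjectiveDimensionLT_X₃ (d + 1) ?_
      (@hasProjectiveDimensionLT_of_ge _ _ _ _ 1 (d + 2) (by omega)
        (ModuleCat.hasProjectiveDimensionLT_one_of_free (M := Fin k → T)))
    have hxF : IsSMulRegular (Fin k → T) x := fun a b hab ↦ funext fun i ↦ hxT (congrFun hab i)
    have := Module.Finite.of_restrictScalars_finite T (T ⧸ Ideal.span {x})
      (QuotSMulTop x (LinearMap.ker g))
    exact hasProjectiveDimensionLT_of_quotSMulTop hx hxT d _ (hxF.submodule _ _)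
      (ih (T ⧸ Ideal.span {x}) hdq _)

open RingTheory.Sequence in
theorem IsRegularLocalRing.exists_isWeaklyRegular (d : ℕ) (T : Type u) [CommRing T]
    [IsRegularLocalRing T] (hd : ringKrullDim T = d) :
    ∃ rs : List T, rs.length = d ∧ (∀ r ∈ rs, r ∈ maximalIdeal T) ∧ IsWeaklyRegular T rs := by
  induction d generalizing T with
  | zero => exact ⟨[], rfl, by simp, IsWeaklyRegular.nil T T⟩
  | succ d ih =>
    obtain ⟨x, hx, hx2, hp⟩ := exists_mem_notMem_sq (T := T) (by rw [hd]; exact_mod_cast d.succ_pos)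
    obtain ⟨h1, h2⟩ := quotient_span_singleton hx hx2
    have hdq : ringKrullDim (T ⧸ Ideal.span {x}) = d := by
      rw [hd, Nat.cast_add, Nat.cast_one] at h2
      exact ENat.WithBot.add_natCast_cancel (c := 1) |>.1 (by simpa using h2)
    have hx0 : x ≠ 0 := by rintro rfl; exact hx2 (Ideal.zero_mem _)
    have hxT : IsSMulRegular T x := fun a b hab ↦ mul_left_cancel₀ hx0 hab
    obtain ⟨rs, hlen, hmem, hreg⟩ := ih (T ⧸ Ideal.span {x}) hdq
    obtain ⟨rs, rfl⟩ := List.map_surjective_iff.2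
      (Ideal.Quotient.mk_surjective (I := Ideal.span {x})) rs
    refine ⟨x :: rs, by simpa using hlen, ?_, IsWeaklyRegular.cons' hxT ?_⟩
    · rintro r (_ | ⟨_, hr⟩)
      · exact hx
      · have := hmem _ (List.mem_map_of_mem hr)
        by_contra hu
        exact (mem_maximalIdeal _).1 this
          ((not_not.1 fun h ↦ hu ((mem_maximalIdeal _).2 h) : IsUnit r).map _)
    · have e : (T ⧸ Ideal.span {x}) ≃ₗ[T ⧸ Ideal.span {x}] QuotSMulTop x T :=
        (Submodule.quotEquivOfEq _ _ (by simp [← Submodule.ideal_span_singleton_smul]) :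
          (T ⧸ Ideal.span {x}) ≃ₗ[T] QuotSMulTop x T).extendScalarsOfSurjective
          Ideal.Quotient.mk_surjective
      exact (e.isWeaklyRegular_congr _).1 hreg

end GlobalDimension

/-! ### Depth through vanishing of Ext from the residue field -/

section ExtDepth

open Abelian RingTheory.Sequence
open scoped Pointwise

variable {R : Type u} [CommRing R] [IsLocalRing R]

/-- `Extᵢ(k, M) = 0` for all `i < n`, where `k` is the residue field. -/
def ExtVanishes (R : Type u) [CommRing R] [IsLocalRing R] (n : ℕ) (M : Type u) [AddCommGroup M]
    [Module R M] : Prop :=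
  ∀ i < n, Subsingleton (Ext (ModuleCat.of R (ResidueField R)) (ModuleCat.of R M) i)

variable {M N P : Type u} [AddCommGroup M] [Module R M] [AddCommGroup N] [Module R N]
  [AddCommGroup P] [Module R P]

lemma ExtVanishes.mono {n m : ℕ} (h : ExtVanishes R n M) (hm : m ≤ n) : ExtVanishes R m M :=
  fun i hi ↦ h i (hi.trans_le hm)

lemma CategoryTheory.Abelian.Ext.eq_zero_of_comp_mono_eq_zero {X Y Z : ModuleCat.{u} R}
    (f : Y ⟶ Z) (hf : Mono f) (a : Ext X Y 0) (h : a.comp (Ext.mk₀ f) (add_zero 0) = 0) : a = 0 := by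
  obtain ⟨a, rfl⟩ := (Ext.mk₀_bijective _ _).2 a
  have h2 : a ≫ f = 0 := by
    rw [Ext.mk₀_comp_mk₀] at h
    exact (Ext.mk₀_bijective _ _).1 (h.trans (Ext.mk₀_zero _ _).symm)
  rw [Limits.zero_of_comp_mono f h2, Ext.mk₀_zero]

lemma ExtVanishes.of_exact₁ {n : ℕ} {f : M →ₗ[R] N} {g : N →ₗ[R] P} (hf : Function.Injective f)
    (hfg : Function.Exact f g) (hg : Function.Surjective g) (hN : ExtVanishes R (n + 1) N)
    (hP : ExtVanishes R n P) : ExtVanishes R (n + 1) M := by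
  have hS := ModuleCat.shortExact_of_exact hf hfg hg
  intro i hi
  refine ⟨fun a b ↦ ?_⟩
  suffices h : ∀ a : Ext (ModuleCat.of R (ResidueField R)) (ModuleCat.of R M) i, a = 0 by
    rw [h a, h b]
  intro a
  have hNi := hN i hi
  cases i with
  | zero =>
    exact Ext.eq_zero_of_comp_mono_eq_zero (ModuleCat.ofHom f) hS.mono_f a
      (Subsingleton.elim _ _)
  | succ i =>
    have hPi := hP i (by omega)
    obtain ⟨x, hx⟩ := Ext.covariant_sequence_exact₁ _ hS a (Subsingleton.elim _ _) rfl
    rw [← hx, show x = 0 from Subsingleton.elim _ _, Ext.zero_comp]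

lemma ExtVanishes.of_exact₃ {n : ℕ} {f : M →ₗ[R] N} {g : N →ₗ[R] P} (hf : Function.Injective f)
    (hfg : Function.Exact f g) (hg : Function.Surjective g) (hN : ExtVanishes R n N)
    (hM : ExtVanishes R (n + 1) M) : ExtVanishes R n P := by
  have hS := ModuleCat.shortExact_of_exact hf hfg hg
  intro i hi
  refine ⟨fun a b ↦ ?_⟩
  suffices h : ∀ a : Ext (ModuleCat.of R (ResidueField R)) (ModuleCat.of R P) i, a = 0 by
    rw [h a, h b]
  intro a
  have hNi := hN i hi
  have hMi := hM (i + 1) (by omega)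
  obtain ⟨x, hx⟩ := Ext.covariant_sequence_exact₃ _ hS a rfl (Subsingleton.elim _ _)
  rw [← hx, show x = 0 from Subsingleton.elim _ _, Ext.zero_comp]

lemma extVanishes_one_iff : ExtVanishes R 1 M ↔
    ∀ x : M, (∀ r ∈ maximalIdeal R, r • x = 0) → x = 0 := by
  constructor
  · intro h x hx
    have h0 := h 0 one_pos
    have : Subsingleton (ModuleCat.of R (ResidueField R) ⟶ ModuleCat.of R M) :=
      (Ext.mk₀_bijective _ _).1.subsingleton
    let φ : ResidueField R →ₗ[R] M :=
      Submodule.liftQ (maximalIdeal R) (LinearMap.toSpanSingleton R M x) hx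
    have hφ : ModuleCat.ofHom φ = 0 := Subsingleton.elim _ _
    have h1 : φ (Submodule.Quotient.mk 1) = 0 := by
      rw [show φ = 0 from ModuleCat.hom_ext_iff.1 hφ]; rfl
    have h2 : φ (Submodule.Quotient.mk 1) = (1 : R) • x := rfl
    rwa [h2, one_smul] at h1
  · intro h i hi
    obtain rfl : i = 0 := by omega
    have : Subsingleton (ModuleCat.of R (ResidueField R) ⟶ ModuleCat.of R M) := by
      refine ⟨fun a b ↦ ?_⟩
      ext y
      rw [← sub_eq_zero]
      refine h _ fun r hr ↦ ?_
      have : r • y = 0 := by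
        rw [Algebra.smul_def]
        exact mul_eq_zero_of_left ((residue_eq_zero_iff r).2 hr) y
      rw [smul_sub, ← map_smul a.hom, ← map_smul b.hom, this, map_zero, map_zero, sub_zero]
    exact (Ext.mk₀_bijective _ _).2.subsingleton

/-- Multiplication by `x` is zero on `Ext(k, M)` because `x` kills `k`, so each class comes from
`Ext(k, M/xM)` one degree lower. -/
lemma ExtVanishes.of_isSMulRegular {n : ℕ} {x : R} (hx : x ∈ maximalIdeal R)
    (hreg : IsSMulRegular M x) (h : ExtVanishes R n (QuotSMulTop x M)) :
    ExtVanishes R (n + 1) M := by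
  have hS := IsSMulRegular.smulShortComplex_shortExact (M := ModuleCat.of R M) hreg
  intro i hi
  refine ⟨fun a b ↦ ?_⟩
  suffices h : ∀ a : Ext (ModuleCat.of R (ResidueField R)) (ModuleCat.of R M) i, a = 0 by
    rw [h a, h b]
  intro a
  have hz : a.comp (Ext.mk₀ (ModuleCat.smulShortComplex (ModuleCat.of R M) x).f) (add_zero i) = 0 := by
    have := Ext.postcomp_smul_id_eq_zero_of_mem_annihilator (N := ModuleCat.of R (ResidueField R))
      (M := ModuleCat.of R M) (r := x) (Module.mem_annihilator.2 fun y ↦ by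
        rw [Algebra.smul_def]
        exact mul_eq_zero_of_left ((residue_eq_zero_iff x).2 hx) y) i
    exact congr($(this) a)
  cases i with
  | zero => exact Ext.eq_zero_of_comp_mono_eq_zero _ hS.mono_f a hz
  | succ i =>
    have hPi : Subsingleton (Ext (ModuleCat.of R (ResidueField R))
      (ModuleCat.smulShortComplex (ModuleCat.of R M) x).X₃ i) := h i (by omega)
    obtain ⟨y, hy⟩ := Ext.covariant_sequence_exact₁ _ hS a hz rfl
    obtain rfl : y = 0 := Subsingleton.elim _ _
    rw [Ext.zero_comp] at hy
    exact hy.symm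

lemma ExtVanishes.of_isWeaklyRegular (rs : List R) (hrs : ∀ r ∈ rs, r ∈ maximalIdeal R)
    (hreg : IsWeaklyRegular M rs) : ExtVanishes R rs.length M := by
  induction rs generalizing M with
  | nil => intro i hi; exact absurd hi (by simp)
  | cons x rs ih =>
    rw [isWeaklyRegular_cons_iff] at hreg
    exact .of_isSMulRegular (hrs x (by simp)) hreg.1 (ih (fun r hr ↦ hrs r (by simp [hr])) hreg.2)

lemma ExtVanishes.quotSMulTop {n : ℕ} {x : R} (hreg : IsSMulRegular M x)
    (h : ExtVanishes R (n + 1) M) : ExtVanishes R n (QuotSMulTop x M) :=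
  ExtVanishes.of_exact₃ (f := LinearMap.lsmul R M x) (g := (x • (⊤ : Submodule R M)).mkQ) hreg
    (LinearMap.exact_lsmul_mkQ_smul_top M x) (Submodule.mkQ_surjective _) (h.mono n.le_succ) h

/-- If `Extᵢ_Λ(k, M) = 0` for `i < n`, then there is a weakly regular sequence of length `n` on `M`
consisting of elements of `R`, for a local homomorphism `R → Λ` such that `𝔪_R Λ = 𝔪_Λ`. -/
theorem ExtVanishes.exists_isWeaklyRegular {A : Type*} [CommRing A] [IsLocalRing A] {Λ : Type u}
    [CommRing Λ] [IsLocalRing Λ] [IsNoetherianRing Λ] [Algebra A Λ]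
    (hm : (maximalIdeal A).map (algebraMap A Λ) = maximalIdeal Λ) (n : ℕ) (M : Type u)
    [AddCommGroup M] [Module Λ M] [Module.Finite Λ M] (h : ExtVanishes Λ n M) :
    ∃ rs : List A, rs.length = n ∧ (∀ r ∈ rs, r ∈ maximalIdeal A) ∧
      IsWeaklyRegular M (rs.map (algebraMap A Λ)) := by
  induction n generalizing M with
  | zero => exact ⟨[], rfl, by simp, IsWeaklyRegular.nil Λ M⟩
  | succ n ih =>
    -- Prime avoidance is run in `A`, on the contractions of the associated primes. If a contraction
    -- contained `𝔪_A`, the prime would contain `𝔪_Λ = 𝔪_A Λ`, and `M` would have a nonzero socle,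
    -- against `Hom(k, M) = 0`.
    obtain ⟨x, hx, hreg⟩ : ∃ x ∈ maximalIdeal A, IsSMulRegular M (algebraMap A Λ x) := by
      by_contra! hc
      have hfin := associatedPrimes.finite Λ M
      have hsub : (maximalIdeal A : Set A) ⊆ ⋃ p ∈ associatedPrimes Λ M,
          (p.comap (algebraMap A Λ) : Set A) := by
        intro x hx
        have : algebraMap A Λ x ∈ ⋃ p ∈ associatedPrimes Λ M, (p : Set Λ) := by
          rw [biUnion_associatedPrimes_eq_compl_regular]
          exact hc x hx
        simpa using this
      obtain ⟨p, hp, hle⟩ := (Ideal.subset_union_prime_finite hfin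
        (f := fun p ↦ p.comap (algebraMap A Λ)) ⊤ ⊤ (fun p hp _ _ ↦ by
          have := IsAssociatedPrime.isPrime hp
          exact Ideal.comap_isPrime _ _)).1 hsub
      have hpm : maximalIdeal Λ ≤ p := by
        rw [← hm]; exact Ideal.map_le_iff_le_comap.2 hle
      obtain ⟨hprime, y, hy⟩ := isAssociatedPrime_iff.mp hp
      have hy0 : y = 0 := extVanishes_one_iff.1 (h.mono (by omega : 1 ≤ n + 1)) y fun r hr ↦ by
        have := hpm hr
        rw [hy] at this
        simpa [Submodule.mem_colon_singleton] using this
      refine hprime.ne_top ((Ideal.eq_top_iff_one _).2 ?_)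
      rw [hy, hy0]
      simp [Submodule.mem_colon_singleton]
    obtain ⟨rs, hlen, hmem, hrs⟩ := ih (QuotSMulTop (algebraMap A Λ x) M) (h.quotSMulTop hreg)
    refine ⟨x :: rs, by simpa using hlen, ?_, hrs.cons hreg⟩
    rintro r (_ | ⟨_, hr⟩)
    · exact hx
    · exact hmem r hr

end ExtDepth

/-! ### Depth of a hypersurface and descent from the completion -/

section HypersurfaceDepth

open RingTheory.Sequence
open scoped Pointwise

theorem RingTheory.Sequence.IsWeaklyRegular.of_isBaseChange_of_faithfullyFlat {R S M N : Type*}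
    [CommRing R] [CommRing S] [Algebra R S] [AddCommGroup M] [Module R M] [AddCommGroup N]
    [Module R N] [Module S N] [IsScalarTower R S N] [Module.FaithfullyFlat R S] {f : M →ₗ[R] N}
    (hf : IsBaseChange S f) {rs : List R} (reg : IsWeaklyRegular N (rs.map (algebraMap R S))) :
    IsWeaklyRegular M rs := by
  induction rs generalizing M N with
  | nil => simp
  | cons x _ ih =>
    simp only [List.map_cons, isWeaklyRegular_cons_iff] at reg ⊢
    have e := (QuotSMulTop.algebraMapTensorEquivTensorQuotSMulTop x M S).symm ≪≫ₗ
      QuotSMulTop.congr ((algebraMap R S) x) hf.equiv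
    have hg : IsBaseChange S <|
        e.toLinearMap.restrictScalars R ∘ₗ TensorProduct.mk R S (QuotSMulTop x M) 1 :=
      IsBaseChange.of_equiv e (fun _ ↦ by simp)
    have hinj : Function.Injective f := by
      have h := hf.equiv.injective.comp
        (Module.FaithfullyFlat.tensorProduct_mk_injective (A := R) (B := S) M)
      intro a b hab
      exact h (by simpa [IsBaseChange.equiv_tmul] using hab)
    refine ⟨fun a b hab ↦ hinj (reg.1 ?_), ih hg reg.2⟩
    simpa using congr(f $hab)

variable {R S T : Type u} [CommRing R] [IsLocalRing R] [IsNoetherianRing R] [CommRing S]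
  [IsLocalRing S] [IsNoetherianRing S] [Algebra R S] [Module.Flat R S]

lemma IsLocalRing.isLocalHom_of_map_maximalIdeal
    (hm : (maximalIdeal R).map (algebraMap R S) = maximalIdeal S) :
    IsLocalHom (algebraMap R S) :=
  ((local_hom_TFAE (algebraMap R S)).out 0 2).2 hm.le

lemma IsLocalRing.faithfullyFlat_of_map_maximalIdeal
    (hm : (maximalIdeal R).map (algebraMap R S) = maximalIdeal S) :
    Module.FaithfullyFlat R S :=
  have := isLocalHom_of_map_maximalIdeal hm
  Module.FaithfullyFlat.of_flat_of_isLocalHom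

/-- Flatness gives going down, so the height formula applies, and the closed fibre is a field and
contributes nothing. -/
lemma IsLocalRing.ringKrullDim_eq_of_map_maximalIdeal
    (hm : (maximalIdeal R).map (algebraMap R S) = maximalIdeal S) :
    ringKrullDim S = ringKrullDim R := by
  have := isLocalHom_of_map_maximalIdeal hm
  have : (maximalIdeal S).LiesOver (maximalIdeal R) :=
    have h : (maximalIdeal S).comap (algebraMap R S) = maximalIdeal R :=
      ((local_hom_TFAE (algebraMap R S)).out 0 4).1 ‹_›
    ⟨h.symm⟩
  have : Algebra.HasGoingDown R S := Algebra.HasGoingDown.of_flat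
  have h := Ideal.height_eq_height_add_of_liesOver_of_hasGoingDown (maximalIdeal R) (maximalIdeal S)
  have h0 : (maximalIdeal S).map
      (Ideal.Quotient.mk ((maximalIdeal R).map (algebraMap R S))) = ⊥ := by
    rw [Ideal.map_eq_bot_iff_le_ker, Ideal.mk_ker, hm]
  have : Nontrivial (S ⧸ (maximalIdeal R).map (algebraMap R S)) := by
    rw [hm]; infer_instance
  have : IsDomain (S ⧸ (maximalIdeal R).map (algebraMap R S)) := by
    rw [hm]; infer_instance
  rw [h0, Ideal.height_bot, add_zero] at h
  rw [← maximalIdeal_height_eq_ringKrullDim, h, maximalIdeal_height_eq_ringKrullDim]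

variable [CommRing T] [IsRegularLocalRing T] {π : T →+* S} {f : T}

open IsRegularLocalRing in
lemma IsRegularLocalRing.ringKrullDim_eq_of_hypersurface (hπ : Function.Surjective π)
    (hker : RingHom.ker π = Ideal.span {f}) (hfm : f ∈ maximalIdeal T) (hf : f ≠ 0) {d : ℕ}
    (hd : ringKrullDim S = d) : ringKrullDim T = (d + 1 : ℕ) := by
  have h := ringKrullDim_quotient_span_singleton_succ_eq_ringKrullDim
    (IsRegular.of_ne_zero hf).left hfm
  rw [← h, ringKrullDim_eq_of_ringEquiv ((Ideal.quotEquivOfEq hker.symm).trans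
    (RingHom.quotientKerEquivOfSurjective hπ)), hd]
  simp

/-- `T` has depth `d + 1`, so `0 → T → T → S → 0` gives `S` depth at least `d` over `T`. This is
turned into a regular sequence from `T`, which is then mapped to `S`, in order to change the base
ring of Ext. -/
lemma extVanishes_of_hypersurface (hπ : Function.Surjective π)
    (hker : RingHom.ker π = Ideal.span {f}) (hfm : f ∈ maximalIdeal T) (hf : f ≠ 0) {d : ℕ}
    (hd : ringKrullDim S = d) : ExtVanishes S d S := by
  obtain ⟨rs, hlen, hmem, hreg⟩ := IsRegularLocalRing.exists_isWeaklyRegular (d + 1) T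
    (IsRegularLocalRing.ringKrullDim_eq_of_hypersurface hπ hker hfm hf hd)
  let := π.toAlgebra
  have h1 : ExtVanishes T (d + 1) T := hlen ▸ ExtVanishes.of_isWeaklyRegular rs hmem hreg
  have h2 : ExtVanishes T d S := by
    refine ExtVanishes.of_exact₃ (f := LinearMap.lsmul T T f) (g := Algebra.linearMap T S)
      (fun a b hab ↦ mul_left_cancel₀ hf hab) (fun y ↦ ?_) hπ (h1.mono d.le_succ) h1
    change y ∈ RingHom.ker π ↔ _
    rw [hker, Ideal.mem_span_singleton]
    exact ⟨fun ⟨c, hc⟩ ↦ ⟨c, hc.symm⟩, fun ⟨c, hc⟩ ↦ ⟨c, hc.symm⟩⟩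
  have : Module.Finite T S := .of_surjective (Algebra.linearMap T S) hπ
  obtain ⟨ts, htlen, htmem, htreg⟩ := ExtVanishes.exists_isWeaklyRegular (A := T) (Λ := T)
    (by simp [Ideal.map_id]) d S h2
  rw [show algebraMap T T = RingHom.id T from rfl, RingHom.coe_id, List.map_id,
    ← isWeaklyRegular_map_algebraMap_iff S S] at htreg
  have hloc : IsLocalHom π := hπ.isLocalHom π
  rw [← htlen, ← List.length_map (algebraMap T S)]
  refine ExtVanishes.of_isWeaklyRegular _ ?_ htreg
  simp only [List.mem_map]
  rintro _ ⟨t, ht, rfl⟩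
  have h3 : (maximalIdeal T).map π ≤ maximalIdeal S := ((local_hom_TFAE π).out 0 2).1 hloc
  exact h3 (Ideal.mem_map_of_mem _ (htmem t ht))

theorem exists_isWeaklyRegular_of_hypersurface
    (hm : (maximalIdeal R).map (algebraMap R S) = maximalIdeal S) (hπ : Function.Surjective π)
    (hker : RingHom.ker π = Ideal.span {f}) (hfm : f ∈ maximalIdeal T) (hf : f ≠ 0) {d : ℕ}
    (hd : ringKrullDim R = d) :
    ∃ rs : List R, rs.length = d ∧ (∀ r ∈ rs, r ∈ maximalIdeal R) ∧ IsWeaklyRegular R rs := by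
  obtain ⟨rs, hlen, hmem, hreg⟩ := ExtVanishes.exists_isWeaklyRegular hm d S
    (extVanishes_of_hypersurface hπ hker hfm hf
      ((ringKrullDim_eq_of_map_maximalIdeal hm).trans hd))
  have := faithfullyFlat_of_map_maximalIdeal hm
  exact ⟨rs, hlen, hmem, .of_isBaseChange_of_faithfullyFlat (IsBaseChange.linearMap R S) hreg⟩

end HypersurfaceDepth

/-! ### Maximal Cohen-Macaulay modules and regular sequences -/

section FreeMCM

open RingTheory.Sequence

variable {R : Type u} [CommRing R] [IsLocalRing R] [IsNoetherianRing R]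
  {M : Type u} [AddCommGroup M] [Module R M]

theorem localDepth_le_ringKrullDim [Module.Finite R M] [Nontrivial M] :
    (localDepth R M : WithBot ℕ∞) ≤ ringKrullDim R := by
  obtain ⟨d, hd⟩ : ∃ d : ℕ∞, ringKrullDim R = d :=
    ⟨_, (maximalIdeal_height_eq_ringKrullDim (R := R)).symm⟩
  rw [hd, WithBot.coe_le_coe]
  refine iSup_le fun rs ↦ ?_
  have hreg : IsRegular M rs.1 :=
    IsRegular.of_isWeaklyRegular_of_mem_maximalIdeal M rs.2.1 rs.2.2
  have h := Module.supportDim_add_length_eq_supportDim_of_isRegular rs.1 hreg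
  have h2 := Module.supportDim_le_ringKrullDim R M
  rw [← WithBot.coe_le_coe, ← hd]
  refine le_trans ?_ (h.le.trans h2)
  have : Nontrivial (M ⧸ Ideal.ofList rs.1 • (⊤ : Submodule R M)) :=
    Submodule.Quotient.nontrivial_iff.2 hreg.2.symm
  obtain ⟨c, hc⟩ := WithBot.ne_bot_iff_exists.1 (Module.supportDim_ne_bot_of_nontrivial R
    (M ⧸ Ideal.ofList rs.1 • (⊤ : Submodule R M)))
  rw [← hc]
  exact_mod_cast le_add_self

theorem IsMaximalCohenMacaulay.of_free [Module.Finite R M] [Nontrivial M] [Module.Free R M]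
    {d : ℕ} (hd : ringKrullDim R = d) (rs : List R) (hlen : rs.length = d)
    (hmem : ∀ r ∈ rs, r ∈ maximalIdeal R) (hreg : IsWeaklyRegular R rs) :
    IsMaximalCohenMacaulay R M := by
  refine ⟨inferInstance, le_antisymm localDepth_le_ringKrullDim ?_⟩
  have h1 : IsWeaklyRegular M rs := by
    have h : IsWeaklyRegular (TensorProduct R M R) rs := hreg.isWeaklyRegular_lTensor
    exact ((TensorProduct.rid R M).isWeaklyRegular_congr rs).1 h
  rw [hd, ← hlen]
  exact WithBot.coe_le_coe.2 (le_iSup (fun rs : {rs : List R //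
      (∀ r ∈ rs, r ∈ maximalIdeal R) ∧ IsWeaklyRegular M rs} ↦ (rs.1.length : ℕ∞)) ⟨rs, hmem, h1⟩)

theorem exists_isWeaklyRegular_of_isMaximalCohenMacaulay (h : IsMaximalCohenMacaulay R M) {d : ℕ}
    (hd : ringKrullDim R = d) :
    ∃ rs : List R, d ≤ rs.length ∧ (∀ r ∈ rs, r ∈ maximalIdeal R) ∧ IsWeaklyRegular M rs := by
  cases d with
  | zero => exact ⟨[], by simp, by simp, IsWeaklyRegular.nil R M⟩
  | succ d =>
    have h1 : localDepth R M = (d + 1 : ℕ) := by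
      have := h.2
      rw [hd] at this
      exact_mod_cast this
    have h2 : (d : ℕ∞) < localDepth R M := by rw [h1]; exact_mod_cast d.lt_succ_self
    obtain ⟨rs, hrs⟩ := lt_iSup_iff.1 h2
    exact ⟨rs.1, by exact_mod_cast Order.add_one_le_of_lt hrs, rs.2⟩

end FreeMCM

/-! ### Vanishing of `Ext¹(N, N)` -/

section ReflexiveExt

open RingTheory.Sequence

lemma Ideal.exists_pow_le_of_forall_isPrime {R : Type*} [CommRing R] [IsLocalRing R]
    [IsNoetherianRing R] (I : Ideal R)
    (h : ∀ p : Ideal R, p.IsPrime → p ≠ maximalIdeal R → ¬ I ≤ p) :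
    ∃ k, maximalIdeal R ^ k ≤ I := by
  refine Ideal.exists_pow_le_of_le_radical_of_fg ?_ (IsNoetherian.noetherian _)
  rw [Ideal.radical_eq_sInf]
  refine le_sInf fun p ⟨hIp, hp⟩ ↦ ?_
  by_contra hne
  exact h p hp (fun h ↦ hne h.ge) hIp

/-- For a surjection `p` onto a module that is locally free on the punctured spectrum, every
element of a power of the maximal ideal can be lifted along `p` as an endomorphism. -/
theorem IsLocallyFreeOnPuncturedSpectrum.exists_comp_eq_smul {R : Type u} [CommRing R]
    [IsLocalRing R] [IsNoetherianRing R] {N P : Type u} [AddCommGroup N] [Module R N]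
    [Module.Finite R N] [AddCommGroup P] [Module R P]
    (hN : IsLocallyFreeOnPuncturedSpectrum R N) (p : P →ₗ[R] N) (hp : Function.Surjective p) :
    ∃ k, ∀ r ∈ maximalIdeal R ^ k, ∃ σ : N →ₗ[R] P, p ∘ₗ σ = r • LinearMap.id := by
  -- `I` consists of the `r` such that `r • id` factors through `p`. At a prime `q ≠ 𝔪` the
  -- localized `p` splits; clearing denominators in the splitting puts an element outside `q` into
  -- `I`. Hence `I` contains a power of `𝔪`.
  let I : Ideal R := (LinearMap.range (p.compRight R (M := N))).comap
    (LinearMap.toSpanSingleton R (N →ₗ[R] N) LinearMap.id)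
  have hI : ∀ r, r ∈ I ↔ ∃ σ : N →ₗ[R] P, p ∘ₗ σ = r • LinearMap.id := fun r ↦ Iff.rfl
  obtain ⟨k, hk⟩ := I.exists_pow_le_of_forall_isPrime fun q hq hqm hIq ↦ by
    have := hN q hqm
    have : Module.FinitePresentation R N := Module.finitePresentation_of_finite R N
    let fN := LocalizedModule.mkLinearMap q.primeCompl N
    let fP := LocalizedModule.mkLinearMap q.primeCompl P
    let p' : LocalizedModule q.primeCompl P →ₗ[Localization.AtPrime q]
      LocalizedModule q.primeCompl N := LocalizedModule.map q.primeCompl p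
    have hp' : Function.Surjective p' := LocalizedModule.map_surjective _ p hp
    obtain ⟨s, hs⟩ := Module.projective_lifting_property p' LinearMap.id hp'
    obtain ⟨h, t, ht⟩ := Module.FinitePresentation.exists_lift_of_isLocalizedModule q.primeCompl
      fP (s.restrictScalars R ∘ₗ fN)
    have h1 : fN ∘ₗ (p ∘ₗ h) = fN ∘ₗ ((t : R) • LinearMap.id) := by
      ext x
      have h2 : fP (h x) = (t : R) • s (fN x) := congr($ht x)
      have h3 : p' (fP (h x)) = fN (p (h x)) := by
        simp [p', fP, fN, LocalizedModule.map_mk]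
      have h4 : p' (s (fN x)) = fN x := congr($hs (fN x))
      have h5 : p' ((t : R) • s (fN x)) = (t : R) • p' (s (fN x)) :=
        (p'.restrictScalars R).map_smul _ _
      simp only [LinearMap.comp_apply, LinearMap.smul_apply, LinearMap.id_apply, map_smul]
      rw [← h3, h2, h5, h4]
    obtain ⟨t', ht'⟩ := Module.Finite.exists_smul_of_comp_eq_of_isLocalizedModule q.primeCompl
      fN _ _ h1
    have h6 : (t' : R) * t ∈ I := by
      refine (hI _).2 ⟨(t' : R) • h, ?_⟩
      rw [LinearMap.comp_smul, mul_smul]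
      exact ht'
    exact (t' * t).2 (hIq h6)
  exact ⟨k, fun r hr ↦ (hI r).1 (hk hr)⟩

variable {R : Type u} [CommRing R] [IsNoetherianRing R]

/-- Dualizing a finite free presentation of `N*` exhibits `N ≅ N**` as a second syzygy. -/
theorem Module.IsReflexive.exists_exact (N : Type u) [AddCommGroup N] [Module R N]
    [Module.Finite R N] [Module.IsReflexive R N] :
    ∃ (F G : Type u) (_ : AddCommGroup F) (_ : AddCommGroup G) (_ : Module R F) (_ : Module R G)
      (_ : Module.Finite R F) (_ : Module.Finite R G) (_ : Module.Free R F) (_ : Module.Free R G)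
      (ι : N →ₗ[R] F) (δ : F →ₗ[R] G), Function.Injective ι ∧ Function.Exact ι δ := by
  have : Module.FinitePresentation R (Module.Dual R N) := Module.finitePresentation_of_finite R _
  obtain ⟨a, b, q, s, hq, hs⟩ := Module.FinitePresentation.exists_fin' R (Module.Dual R N)
  refine ⟨Module.Dual R (Fin a → R), Module.Dual R (Fin b → R), inferInstance, inferInstance,
    inferInstance, inferInstance, inferInstance, inferInstance, inferInstance, inferInstance,
    q.dualMap ∘ₗ (Module.evalEquiv R N).toLinearMap, s.dualMap,
    (LinearMap.lcomp_injective_of_surjective q hq).comp (Module.evalEquiv R N).injective, ?_⟩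
  have h := LinearMap.exact_lcomp_of_exact_of_surjective R hs hq
  intro x
  refine (h x).trans ?_
  exact ⟨fun ⟨y, hy⟩ ↦ ⟨(Module.evalEquiv R N).symm y,
    (congrArg q.dualMap ((Module.evalEquiv R N).apply_symm_apply y)).trans hy⟩,
    fun ⟨y, hy⟩ ↦ ⟨Module.evalEquiv R N y, hy⟩⟩

variable [IsLocalRing R] {M N P F G K : Type u} [AddCommGroup M] [Module R M] [AddCommGroup N]
  [Module R N] [AddCommGroup P] [Module R P] [AddCommGroup F] [Module R F] [AddCommGroup G]
  [Module R G]

lemma ExtVanishes.zero (M : Type u) [AddCommGroup M] [Module R M] : ExtVanishes R 0 M :=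
  fun i hi ↦ absurd hi i.not_lt_zero

lemma ExtVanishes.of_injective {f : M →ₗ[R] N} (hf : Function.Injective f)
    (hN : ExtVanishes R 1 N) : ExtVanishes R 1 M :=
  .of_exact₁ (g := (LinearMap.range f).mkQ) hf
    (LinearMap.exact_iff.2 (by simp)) (Submodule.mkQ_surjective _) hN (.zero _)

lemma ExtVanishes.two_of_exact {f : M →ₗ[R] F} {g : F →ₗ[R] G} (hf : Function.Injective f)
    (hfg : Function.Exact f g) (hF : ExtVanishes R 2 F) (hG : ExtVanishes R 1 G) :
    ExtVanishes R 2 M :=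
  .of_exact₁ (g := g.rangeRestrict) hf (fun x ↦ by rw [← hfg x, Subtype.ext_iff]; rfl)
    g.surjective_rangeRestrict hF (.of_injective (Submodule.injective_subtype _) hG)

lemma ExtVanishes.linearMap_one (hN : ExtVanishes R 1 N) : ExtVanishes R 1 (M →ₗ[R] N) := by
  rw [extVanishes_one_iff] at hN ⊢
  refine fun φ hφ ↦ LinearMap.ext fun x ↦ hN _ fun r hr ↦ ?_
  exact congr($(hφ r hr) x)

/-- A module without socle that is killed by a power of `𝔪` is zero. -/
lemma ExtVanishes.subsingleton (hN : ExtVanishes R 1 N) (k : ℕ)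
    (hk : ∀ r ∈ maximalIdeal R ^ k, ∀ x : N, r • x = 0) : Subsingleton N := by
  rw [extVanishes_one_iff] at hN
  induction k with
  | zero => exact ⟨fun x y ↦ by rw [← one_smul R x, ← one_smul R y, hk 1 (by simp), hk 1 (by simp)]⟩
  | succ k ih =>
    refine ih fun r hr x ↦ hN _ fun s hs ↦ ?_
    rw [← mul_smul, mul_comm]
    exact hk _ (by rw [pow_succ]; exact Ideal.mul_mem_mul hr hs) x

lemma RingTheory.Sequence.IsWeaklyRegular.extVanishes_of_flat {rs : List R}
    (hrs : ∀ r ∈ rs, r ∈ maximalIdeal R) (hreg : IsWeaklyRegular R rs) (F : Type u)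
    [AddCommGroup F] [Module R F] [Module.Flat R F] : ExtVanishes R rs.length F := by
  have h : IsWeaklyRegular (TensorProduct R F R) rs := hreg.isWeaklyRegular_lTensor
  exact .of_isWeaklyRegular rs hrs (((TensorProduct.rid R F).isWeaklyRegular_congr rs).1 h)

/-- If `N` is reflexive and locally free on the punctured spectrum, the depth of the ring is at
least two, and the depth of `Hom(N, N)` is at least three, then `Ext¹(N, N) = 0`. -/
theorem exists_extension_of_extVanishes [Module.Finite R N] [Module.IsReflexive R N]
    (hfree : IsLocallyFreeOnPuncturedSpectrum R N) {rs : List R} (hlen : 2 ≤ rs.length)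
    (hrs : ∀ r ∈ rs, r ∈ maximalIdeal R) (hreg : IsWeaklyRegular R rs)
    (hHom : ExtVanishes R 3 (N →ₗ[R] N)) [Module.Finite R P] [Module.Free R P]
    (p : P →ₗ[R] N) (hp : Function.Surjective p) (φ : LinearMap.ker p →ₗ[R] N) :
    ∃ ψ : P →ₗ[R] N, ψ ∘ₗ (LinearMap.ker p).subtype = φ := by
  obtain ⟨F, G, _, _, _, _, _, _, _, _, ι, δ, hι, hδ⟩ := Module.IsReflexive.exists_exact (R := R) N
  have hflat : ∀ (F : Type u) [AddCommGroup F] [Module R F] [Module.Flat R F],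
      ExtVanishes R 2 F := fun F _ _ _ ↦ (hreg.extVanishes_of_flat hrs F).mono hlen
  have hN : ExtVanishes R 2 N := .two_of_exact hι hδ (hflat F) ((hflat G).mono one_le_two)
  have hPN : ExtVanishes R 2 (P →ₗ[R] N) := by
    refine .two_of_exact (f := ι.compRight R) (g := δ.compRight R) (fun a b hab ↦ ?_)
      (fun α ↦ ⟨fun hα ↦ ?_, ?_⟩) (hflat _) ((hflat _).mono one_le_two)
    · exact LinearMap.ext fun x ↦ hι congr($hab x)
    · obtain ⟨β, hβ⟩ := Module.projective_lifting_property ι.rangeRestrict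
        (α.codRestrict (LinearMap.range ι) fun x ↦ (hδ _).1 congr($hα x))
        ι.surjective_rangeRestrict
      exact ⟨β, LinearMap.ext fun x ↦ congr(($hβ x : F))⟩
    · rintro ⟨β, rfl⟩
      exact LinearMap.ext fun x ↦ hδ.apply_apply_eq_zero _
  let f : (N →ₗ[R] N) →ₗ[R] (P →ₗ[R] N) := LinearMap.lcomp R N p
  let g : (P →ₗ[R] N) →ₗ[R] (LinearMap.ker p →ₗ[R] N) :=
    LinearMap.lcomp R N (LinearMap.ker p).subtype
  have hf : Function.Injective f := LinearMap.lcomp_injective_of_surjective p hp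
  have hfg : Function.Exact f g := LinearMap.exact_lcomp_of_exact_of_surjective N
    (LinearMap.exact_subtype_ker_map p) hp
  -- The depth count along `0 → Hom(N, N) → Hom(P, N) → Hom(K, N) → Ext¹(N, N) → 0`: depths at least
  -- 3 and 2 give the middle image depth at least 2. As `Hom(K, N)` has depth at least 1, so does
  -- the cokernel.
  have hC : ExtVanishes R 2 (LinearMap.range g) :=
    .of_exact₃ (f := f) (g := g.rangeRestrict) hf (fun x ↦ by rw [← hfg x, Subtype.ext_iff]; rfl)
      g.surjective_rangeRestrict hPN hHom
  have hE : ExtVanishes R 1 ((LinearMap.ker p →ₗ[R] N) ⧸ LinearMap.range g) :=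
    .of_exact₃ (f := (LinearMap.range g).subtype) (g := (LinearMap.range g).mkQ)
      (Submodule.injective_subtype _) (LinearMap.exact_subtype_mkQ _)
      (Submodule.mkQ_surjective _) ((hN.mono one_le_two).linearMap_one) hC
  obtain ⟨k, hk⟩ := hfree.exists_comp_eq_smul p hp
  have hsub := hE.subsingleton k fun r hr x ↦ by
    obtain ⟨φ, rfl⟩ := Submodule.mkQ_surjective _ x
    obtain ⟨σ, hσ⟩ := hk r hr
    rw [← map_smul, Submodule.mkQ_apply, Submodule.Quotient.mk_eq_zero]
    -- `r - σ p` maps `P` into `K` and is multiplication by `r` on `K`, so composing it with `φ`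
    -- extends `r φ` to `P`.
    have hκ : ∀ x, (r • LinearMap.id - σ ∘ₗ p : P →ₗ[R] P) x ∈ LinearMap.ker p := fun x ↦ by
      have : p (σ (p x)) = r • p x := congr($hσ (p x))
      simp [this]
    refine ⟨φ ∘ₗ (r • LinearMap.id - σ ∘ₗ p).codRestrict (LinearMap.ker p) hκ,
      LinearMap.ext fun y ↦ ?_⟩
    have : (r • LinearMap.id - σ ∘ₗ p).codRestrict (LinearMap.ker p) hκ y = r • y := by
      ext; simp [LinearMap.mem_ker.1 y.2]
    change φ ((r • LinearMap.id - σ ∘ₗ p).codRestrict (LinearMap.ker p) hκ y) = r • φ y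
    rw [this, map_smul]
  have hφ : φ ∈ LinearMap.range g :=
    (Submodule.Quotient.mk_eq_zero _).1 (hsub.elim (Submodule.Quotient.mk φ) 0)
  exact hφ

end ReflexiveExt

/-! ### Matrix factorizations from third syzygies -/

section MatrixFactorization

open Matrix

/-- A finite module of projective dimension at most one that is killed by a nonzero element `f` of
a local domain is the cokernel of a matrix factorization of `f`. -/
theorem exists_matrixFactorization {T : Type u} [CommRing T] [IsDomain T] [IsLocalRing T]
    [IsNoetherianRing T] {f : T} (hf : f ≠ 0) (K : Type u) [AddCommGroup K] [Module T K]
    [Module.Finite T K] (hK : HasProjectiveDimensionLT (ModuleCat.of T K) 2)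
    (hfK : ∀ x : K, f • x = 0) :
    ∃ (n : ℕ) (A B : Matrix (Fin n) (Fin n) T) (q : (Fin n → T) →ₗ[T] K),
      A * B = f • 1 ∧ B * A = f • 1 ∧ Function.Surjective q ∧
        LinearMap.ker q = LinearMap.range A.mulVecLin := by
  obtain ⟨n, q, hq⟩ := Module.Finite.exists_fin' T K
  have := ModuleCat.free_of_hasProjectiveDimensionLT_one
    (ModuleCat.hasProjectiveDimensionLT_ker q hq 1 ModuleCat.hasProjectiveDimensionLT_one_of_free hK)
  have hmem : ∀ x, f • x ∈ LinearMap.ker q := fun x ↦ by simp [hfK]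
  let φ : (Fin n → T) →ₗ[T] LinearMap.ker q :=
    (f • LinearMap.id : (Fin n → T) →ₗ[T] Fin n → T).codRestrict _ hmem
  have hφ : Function.Injective φ := fun x y hxy ↦ by
    have : f • x = f • y := congr(($hxy : Fin n → T))
    exact smul_right_injective _ hf this
  -- The free module `ker q` lies between `f Tⁿ` and `Tⁿ`, so its rank is `n` and the presentation
  -- matrix is square.
  have hrank : Module.finrank T (LinearMap.ker q) = n := by
    refine le_antisymm ?_ ?_
    · simpa using LinearMap.finrank_le_finrank_of_injective
        (Submodule.injective_subtype (LinearMap.ker q))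
    · simpa using LinearMap.finrank_le_finrank_of_injective hφ
  let e : (Fin n → T) ≃ₗ[T] LinearMap.ker q :=
    ((Module.finBasisOfFinrankEq T (LinearMap.ker q) hrank).equivFun).symm
  let α : (Fin n → T) →ₗ[T] (Fin n → T) := (LinearMap.ker q).subtype ∘ₗ e.toLinearMap
  have hα : Function.Injective α := (Submodule.injective_subtype _).comp e.injective
  let β : (Fin n → T) →ₗ[T] (Fin n → T) := e.symm.toLinearMap ∘ₗ φ
  have hαβ : α ∘ₗ β = f • LinearMap.id := by
    ext1; ext1; simp [α, β, φ]
  have hβα : β ∘ₗ α = f • LinearMap.id := by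
    refine LinearMap.ext fun x ↦ hα ?_
    have : α (β (α x)) = f • α x := congr($hαβ (α x))
    simpa using this
  refine ⟨n, LinearMap.toMatrix' α, LinearMap.toMatrix' β, q, ?_, ?_, hq, ?_⟩
  · rw [← LinearMap.toMatrix'_comp, hαβ, map_smul, LinearMap.toMatrix'_id]
  · rw [← LinearMap.toMatrix'_comp, hβα, map_smul, LinearMap.toMatrix'_id]
  · rw [← Matrix.toLin'_apply', Matrix.toLin'_toMatrix', LinearMap.range_comp,
      LinearEquiv.range, Submodule.map_top, Submodule.range_subtype]

variable {S T : Type u} [CommRing S] [CommRing T] [Algebra T S] {f : T}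

lemma hasProjectiveDimensionLT_pi_of_ker_eq_span_singleton [IsDomain T]
    (hπ : Function.Surjective (algebraMap T S))
    (hker : RingHom.ker (algebraMap T S) = Ideal.span {f}) (hf : f ≠ 0) (c : ℕ) :
    HasProjectiveDimensionLT (ModuleCat.of T (Fin c → S)) 2 := by
  have h1 : Function.Injective (f • LinearMap.id : (Fin c → T) →ₗ[T] Fin c → T) :=
    fun x y hxy ↦ smul_right_injective _ hf hxy
  have h2 : Function.Surjective ((Algebra.linearMap T S).compLeft (Fin c)) := fun y ↦ by
    choose x hx using fun i ↦ hπ (y i)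
    exact ⟨x, funext hx⟩
  have h3 : Function.Exact (f • LinearMap.id : (Fin c → T) →ₗ[T] Fin c → T)
      ((Algebra.linearMap T S).compLeft (Fin c)) := fun x ↦ by
    have h : ∀ i, algebraMap T S (x i) = 0 ↔ f ∣ x i := fun i ↦ by
      rw [← RingHom.mem_ker, hker, Ideal.mem_span_singleton]
    constructor
    · intro hx
      choose y hy using fun i ↦ (h i).1 (congrFun hx i)
      exact ⟨y, funext fun i ↦ (hy i).symm⟩
    · rintro ⟨y, rfl⟩
      exact funext fun i ↦ (h i).2 ⟨y i, rfl⟩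
  exact (ModuleCat.shortExact_of_exact h1 h3 h2).hasProjectiveDimensionLT_X₃ 1
    ModuleCat.hasProjectiveDimensionLT_one_of_free
    (@hasProjectiveDimensionLT_of_ge _ _ _ _ 1 2 (by omega)
      ModuleCat.hasProjectiveDimensionLT_one_of_free)

/-- Over a hypersurface of dimension three, the kernel of the first map of an exact sequence
`Sᵇ → Sᵃ → Sᶜ` has a two-periodic free resolution given by a matrix factorization. -/
theorem exists_isPeriodicResolution [IsRegularLocalRing T] (hd : ringKrullDim T = 4)
    (hπ : Function.Surjective (algebraMap T S))
    (hker : RingHom.ker (algebraMap T S) = Ideal.span {f}) (hf : f ≠ 0) {a b c : ℕ}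
    (p : (Fin b → S) →ₗ[S] (Fin a → S)) (δ : (Fin a → S) →ₗ[S] (Fin c → S))
    (hpδ : Function.Exact p δ) :
    ∃ (n : ℕ) (A B : Matrix (Fin n) (Fin n) T) (u : Matrix (Fin b) (Fin n) S),
      A * B = f • 1 ∧ B * A = f • 1 ∧ LinearMap.ker p = LinearMap.range u.mulVecLin ∧
      IsPeriodicResolution (A.map (algebraMap T S)) (B.map (algebraMap T S)) u := by
  have hfin : Module.Finite T S := .of_surjective (Algebra.linearMap T S) hπ
  have hpd : ∀ (c n : ℕ), 2 ≤ n → HasProjectiveDimensionLT (ModuleCat.of T (Fin c → S)) n :=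
    fun c n hn ↦ @hasProjectiveDimensionLT_of_ge _ _ _ _ 2 n hn
      (hasProjectiveDimensionLT_pi_of_ker_eq_span_singleton hπ hker hf c)
  let p' : (Fin b → S) →ₗ[T] (Fin a → S) := p.restrictScalars T
  let δ' : (Fin a → S) →ₗ[T] (Fin c → S) := δ.restrictScalars T
  -- Strict bounds: the cokernel of `δ` has projective dimension at most 4 over `T`. Free
  -- `S`-modules have dimension at most 1, so each of the three successive kernels lowers the bound
  -- by one, ending with at most 1 for `ker p`.
  have hC : HasProjectiveDimensionLT (ModuleCat.of T ((Fin c → S) ⧸ LinearMap.range δ')) 5 :=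
    IsRegularLocalRing.hasProjectiveDimensionLE 4 T hd _
  have hδ : HasProjectiveDimensionLT (ModuleCat.of T (LinearMap.range δ')) 4 := by
    have := ModuleCat.hasProjectiveDimensionLT_ker (LinearMap.range δ').mkQ
      (Submodule.mkQ_surjective _) 4 (hpd c 4 (by omega)) hC
    rwa [Submodule.ker_mkQ] at this
  have hp : HasProjectiveDimensionLT (ModuleCat.of T (LinearMap.range p')) 3 := by
    have := ModuleCat.hasProjectiveDimensionLT_ker δ'.rangeRestrict δ'.surjective_rangeRestrict 3
      (hpd a 3 (by omega)) hδ
    rwa [LinearMap.ker_rangeRestrict, show LinearMap.ker δ' = LinearMap.range p' from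
      LinearMap.exact_iff.1 hpδ] at this
  have hK : HasProjectiveDimensionLT (ModuleCat.of T (LinearMap.ker p')) 2 := by
    have := ModuleCat.hasProjectiveDimensionLT_ker p'.rangeRestrict p'.surjective_rangeRestrict 2
      (hpd b 2 le_rfl) hp
    rwa [LinearMap.ker_rangeRestrict] at this
  have hf0 : algebraMap T S f = 0 := by
    rw [← RingHom.mem_ker, hker]; exact Ideal.mem_span_singleton_self f
  obtain ⟨n, A, B, q, hAB, hBA, hq, hqA⟩ := exists_matrixFactorization hf (LinearMap.ker p') hK
    fun x ↦ by
      ext i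
      simp [Algebra.smul_def, hf0]
  let u : Matrix (Fin b) (Fin n) S := fun i j ↦ (q (Pi.single j 1) : Fin b → S) i
  have hu : ∀ v : Fin n → T, u *ᵥ (algebraMap T S ∘ v) = (q v : Fin b → S) := fun v ↦ by
    have h1 : v = ∑ j, v j • (Pi.single j 1 : Fin n → T) := by
      ext i; simp [Finset.sum_apply, Pi.single_apply]
    have h2 : q v = ∑ j, v j • q (Pi.single j 1) := by
      conv_lhs => rw [h1]
      simp only [map_sum, map_smul]
    rw [h2]
    ext i
    simp [u, mulVec, dotProduct, Algebra.smul_def, mul_comm]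
  have hlift : ∀ v : Fin n → S, ∃ w : Fin n → T, algebraMap T S ∘ w = v := fun v ↦ by
    choose x hx using fun i ↦ hπ (v i)
    exact ⟨x, funext hx⟩
  have hmul : ∀ w : Fin n → T, algebraMap T S ∘ (A *ᵥ w) =
      A.map (algebraMap T S) *ᵥ (algebraMap T S ∘ w) := fun w ↦ by
    ext i; simp [mulVec, dotProduct]
  refine ⟨n, A, B, u, hAB, hBA, ?_, isPeriodicResolution_map hπ hker
    (mem_nonZeroDivisors_of_ne_zero hf) hAB hBA u ?_ ?_⟩
  · ext x
    constructor
    · intro hx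
      obtain ⟨v, hv⟩ := hq ⟨x, hx⟩
      exact ⟨algebraMap T S ∘ v, by rw [mulVecLin_apply, hu, hv]⟩
    · rintro ⟨v, rfl⟩
      obtain ⟨w, rfl⟩ := hlift v
      rw [mulVecLin_apply, hu]
      exact (q w).2
  · refine Matrix.ext_of_mulVec_single fun j ↦ ?_
    have h1 : (Pi.single j 1 : Fin n → S) = algebraMap T S ∘ (Pi.single j 1 : Fin n → T) := by
      ext i; by_cases h : i = j <;> simp [h]
    have h2 : q (A *ᵥ Pi.single j 1) = 0 := by
      rw [← LinearMap.mem_ker, hqA]; exact ⟨_, rfl⟩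
    rw [← mulVec_mulVec, h1, ← hmul, hu, h2, zero_mulVec]
    rfl
  · intro v hv
    obtain ⟨w, rfl⟩ := hlift v
    rw [hu] at hv
    have : w ∈ LinearMap.range A.mulVecLin := by
      rw [← hqA]; exact Subtype.ext hv
    obtain ⟨x, rfl⟩ := this
    exact ⟨algebraMap T S ∘ x, hmul x⟩

end MatrixFactorization

/-! ### Finite length from annihilation by a power of the maximal ideal -/

section FiniteLength

variable {S : Type*} [CommRing S] [IsLocalRing S] [IsNoetherianRing S]

lemma IsLocalRing.isArtinianRing_quotient_pow (k : ℕ) : IsArtinianRing (S ⧸ maximalIdeal S ^ k) := by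
  have : Ring.KrullDimLE 0 (S ⧸ maximalIdeal S ^ k) := by
    rw [Ring.krullDimLE_zero_iff]
    intro P hP
    have hcomap : P.comap (Ideal.Quotient.mk (maximalIdeal S ^ k)) = maximalIdeal S := by
      refine (le_maximalIdeal (Ideal.IsPrime.ne_top inferInstance)).antisymm ?_
      refine Ideal.IsPrime.le_of_pow_le (n := k) ?_
      intro x hx
      rw [Ideal.mem_comap, Ideal.Quotient.eq_zero_iff_mem.2 hx]
      exact P.zero_mem
    have hmap := Ideal.map_comap_of_surjective _ Ideal.Quotient.mk_surjective P
    rw [hcomap] at hmap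
    rw [← hmap]
    refine (Ideal.map_eq_top_or_isMaximal_of_surjective _ Ideal.Quotient.mk_surjective
      inferInstance).resolve_left fun h ↦ hP.ne_top (hmap ▸ h)
  exact isArtinianRing_iff_isNoetherianRing_krullDimLE_zero.2 ⟨inferInstance, this⟩

theorem IsLocalRing.length_ne_top_of_pow_smul_eq_zero {M : Type*} [AddCommGroup M] [Module S M]
    [Module.Finite S M] (k : ℕ) (h : ∀ r ∈ maximalIdeal S ^ k, ∀ x : M, r • x = 0) :
    Module.length S M ≠ ⊤ := by
  have := isArtinianRing_quotient_pow (S := S) k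
  have htor : Module.IsTorsionBySet S M (maximalIdeal S ^ k : Ideal S) := fun x r ↦ h r r.2 x
  let := htor.module
  have : IsScalarTower S (S ⧸ maximalIdeal S ^ k) M := htor.isScalarTower
  have : Module.Finite (S ⧸ maximalIdeal S ^ k) M := .of_restrictScalars_finite S _ _
  rw [Module.length_eq_of_surjective (R := S ⧸ maximalIdeal S ^ k) Ideal.Quotient.mk_surjective]
  exact Module.length_ne_top

theorem Submodule.relLength_ne_top_of_smul_mem {R : Type*} [CommRing R] [IsLocalRing R]
    [Algebra R S] (hm : (maximalIdeal R).map (algebraMap R S) = maximalIdeal S) {M : Type*}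
    [AddCommGroup M] [Module S M] [Module.Finite S M] {Q P : Submodule S M} (k : ℕ)
    (h : ∀ r ∈ maximalIdeal R ^ k, ∀ x ∈ P, algebraMap R S r • x ∈ Q) : Q.relLength P ≠ ⊤ := by
  have : IsNoetherian S M := isNoetherian_of_isNoetherianRing_of_finite S M
  refine length_ne_top_of_pow_smul_eq_zero k fun r hr x ↦ ?_
  have hle : maximalIdeal S ^ k ≤ Q.colon (P : Set M) := by
    rw [← hm, ← Ideal.map_pow, Ideal.map_le_iff_le_comap]
    exact fun r hr ↦ Submodule.mem_colon.2 (h r hr)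
  obtain ⟨x, rfl⟩ := Submodule.mkQ_surjective _ x
  rw [← map_smul, Submodule.mkQ_apply, Submodule.Quotient.mk_eq_zero]
  exact Submodule.mem_colon.1 (hle hr) x x.2

end FiniteLength

/-! ### Base change of the extension property -/

section BaseChangeExtension

open TensorProduct

/-- The property that homomorphisms from a kernel extend to the whole module is preserved under
flat base change. -/
theorem LinearMap.exists_extension_baseChange {R S : Type*} [CommRing R] [IsNoetherianRing R]
    [CommRing S] [Algebra R S] [Module.Flat R S] {P N : Type*} [AddCommGroup P] [Module R P]
    [Module.Finite R P] [AddCommGroup N] [Module R N] (p : P →ₗ[R] N)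
    (h : ∀ φ : LinearMap.ker p →ₗ[R] N, ∃ ψ : P →ₗ[R] N, ψ ∘ₗ (LinearMap.ker p).subtype = φ)
    (φ : S ⊗[R] LinearMap.ker p →ₗ[S] S ⊗[R] N) :
    ∃ ψ : S ⊗[R] P →ₗ[S] S ⊗[R] N, ψ ∘ₗ (LinearMap.ker p).subtype.baseChange S = φ := by
  have : Module.FinitePresentation R (LinearMap.ker p) := Module.finitePresentation_of_finite R _
  -- Hom out of the finitely presented module `ker p` commutes with flat base change, so `φ` is an
  -- `S`-combination of maps defined over `R`.
  refine (Module.FinitePresentation.isBaseChange_map R (LinearMap.ker p) N S).inductionOn φ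
    (fun φ ↦ ∃ ψ : S ⊗[R] P →ₗ[S] S ⊗[R] N, ψ ∘ₗ (LinearMap.ker p).subtype.baseChange S = φ)
    ⟨0, by simp⟩ (fun φ ↦ ?_) (fun s φ ⟨ψ, hψ⟩ ↦ ⟨s • ψ, by rw [LinearMap.smul_comp, hψ]⟩)
    (fun φ φ' ⟨ψ, hψ⟩ ⟨ψ', hψ'⟩ ↦ ⟨ψ + ψ', by rw [LinearMap.add_comp, hψ, hψ']⟩)
  obtain ⟨ψ, rfl⟩ := h φ
  exact ⟨ψ.baseChange S, (LinearMap.baseChange_comp _ _).symm⟩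

end BaseChangeExtension

/-! ### From homomorphisms to matrices -/

namespace Matrix.IsPeriodicResolution

open Matrix

variable {S : Type*} [CommRing S] {b n : Type*} [Fintype b] [Fintype n] [DecidableEq b]
  [DecidableEq n] {A B : Matrix n n S} {u : Matrix b n S} {N : Type*} [AddCommGroup N] [Module S N]
  {p : (b → S) →ₗ[S] N}

lemma exists_eq_mul_of_forall_mulVec_mem {k : Type*} [Fintype k] [DecidableEq k]
    (hpu : LinearMap.ker p = LinearMap.range u.mulVecLin) (X : Matrix b k S)
    (hX : ∀ v, p (X *ᵥ v) = 0) : ∃ Y : Matrix n k S, X = u * Y := by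
  have h : ∀ j, ∃ w : n → S, u *ᵥ w = X *ᵥ Pi.single j 1 := fun j ↦ by
    have : X *ᵥ Pi.single j 1 ∈ LinearMap.range u.mulVecLin := by rw [← hpu]; exact hX _
    exact this
  choose w hw using h
  refine ⟨Matrix.of fun i j ↦ w j i, Matrix.ext_of_mulVec_single fun j ↦ ?_⟩
  rw [← hw, ← mulVec_mulVec]
  congr 1
  ext i
  simp

/-- If every homomorphism `ker p → N` extends to the source of `p`, then every morphism from the
resolution of `ker p` is a combination of the evident ones. -/
theorem exists_eq_mul_add_mul (h : IsPeriodicResolution A B u) (hp : Function.Surjective p)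
    (hpu : LinearMap.ker p = LinearMap.range u.mulVecLin)
    (hext : ∀ φ : LinearMap.ker p →ₗ[S] N, ∃ ψ : (b → S) →ₗ[S] N,
      ψ ∘ₗ (LinearMap.ker p).subtype = φ) (Φ : Matrix b n S) (Z : Matrix n n S)
    (hΦ : Φ * A = u * Z) : ∃ (Ψ : Matrix b b S) (Θ : Matrix n n S), Φ = Ψ * u + u * Θ := by
  let u' : (n → S) →ₗ[S] LinearMap.ker p := u.mulVecLin.codRestrict _ fun x ↦ hpu ▸ ⟨x, rfl⟩
  have hu' : Function.Surjective u' := fun ⟨y, hy⟩ ↦ by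
    obtain ⟨x, rfl⟩ : y ∈ LinearMap.range u.mulVecLin := hpu ▸ hy
    exact ⟨x, rfl⟩
  have hle : LinearMap.ker u' ≤ LinearMap.ker (p ∘ₗ Φ.mulVecLin) := fun v hv ↦ by
    obtain ⟨w, rfl⟩ := h.exact_u v congr(($hv : b → S))
    rw [LinearMap.mem_ker, LinearMap.comp_apply, mulVecLin_apply, mulVec_mulVec, hΦ,
      ← LinearMap.mem_ker, hpu, ← mulVec_mulVec]
    exact ⟨_, rfl⟩
  obtain ⟨ψ, hψ⟩ := hext
    ((LinearMap.ker u').liftQ (p ∘ₗ Φ.mulVecLin) hle ∘ₗ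
      (u'.quotKerEquivOfSurjective hu').symm.toLinearMap)
  obtain ⟨Ψ, hΨ⟩ := Module.projective_lifting_property p ψ hp
  obtain ⟨Θ, hΘ⟩ := exists_eq_mul_of_forall_mulVec_mem hpu (Φ - LinearMap.toMatrix' Ψ * u)
    fun v ↦ by
      have h1 : (u'.quotKerEquivOfSurjective hu').symm (u' v) = Submodule.Quotient.mk v := by
        rw [LinearEquiv.symm_apply_eq]; rfl
      have h2 : ψ (u *ᵥ v) = p (Φ *ᵥ v) := by
        have := congr($hψ (u' v))
        simp only [LinearMap.comp_apply, LinearEquiv.coe_coe, h1] at this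
        exact this
      have h3 : p (Ψ (u *ᵥ v)) = ψ (u *ᵥ v) := congr($hΨ _)
      rw [sub_mulVec, map_sub, ← mulVec_mulVec, LinearMap.toMatrix'_mulVec, h3, h2, sub_self]
  exact ⟨LinearMap.toMatrix' Ψ, Θ, by rw [← hΘ]; abel⟩

/-- `Υ` is the matrix of `σ p`, which kills the image of `u`; the difference `r - σ p` has values in
`ker p`, hence factors through `u`. The next two lemmas use this to show that `r` kills `Ext¹(N, S)`
and `Tor(N*, N)`. -/
lemma exists_smul_eq_add (hpu : LinearMap.ker p = LinearMap.range u.mulVecLin) {r : S}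
    (σ : N →ₗ[S] (b → S)) (hσ : p ∘ₗ σ = r • LinearMap.id) :
    ∃ (Υ : Matrix b b S) (Θ : Matrix n b S), r • 1 = Υ + u * Θ ∧ Υ * u = 0 := by
  obtain ⟨Θ, hΘ⟩ := exists_eq_mul_of_forall_mulVec_mem hpu
    (r • 1 - LinearMap.toMatrix' (σ ∘ₗ p)) fun v ↦ by
      have : p (σ (p v)) = r • p v := congr($hσ _)
      rw [sub_mulVec, map_sub, LinearMap.toMatrix'_mulVec, LinearMap.comp_apply, this, smul_mulVec,
        one_mulVec, map_smul, sub_self]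
  refine ⟨LinearMap.toMatrix' (σ ∘ₗ p), Θ, by rw [← hΘ]; abel,
    Matrix.ext_of_mulVec_single fun j ↦ ?_⟩
  have : p (u *ᵥ Pi.single j 1) = 0 := by
    rw [← LinearMap.mem_ker, hpu]; exact ⟨_, rfl⟩
  rw [← mulVec_mulVec, LinearMap.toMatrix'_mulVec, LinearMap.comp_apply, this, map_zero,
    zero_mulVec]

lemma smul_mem_range_mulRight (h : IsPeriodicResolution A B u) {r : S} {Υ : Matrix b b S}
    {Θ : Matrix n b S} (hr : r • 1 = Υ + u * Θ) (hu : Υ * u = 0) {X : Matrix n n S}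
    (hX : X * A = 0) : r • X ∈ LinearMap.range (mulRightLinearMap n S u) := by
  have h1 : u * (Θ * u - r • 1) = 0 := by
    have : r • u = u * Θ * u := by
      rw [← Matrix.one_mul u, ← Matrix.smul_mul, hr, Matrix.add_mul, hu, zero_add, Matrix.one_mul]
    rw [Matrix.mul_sub, ← Matrix.mul_assoc, ← this, Matrix.mul_smul, Matrix.mul_one, sub_self]
  obtain ⟨V, hV⟩ := exists_eq_mul_of_mulVec h.exact_u _ h1
  refine ⟨X * Θ, ?_⟩
  have h2 : X * (Θ * u - r • 1) = 0 := by rw [hV, ← Matrix.mul_assoc, hX, Matrix.zero_mul]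
  rw [Matrix.mul_sub, Matrix.mul_smul, Matrix.mul_one, sub_eq_zero, ← Matrix.mul_assoc] at h2
  exact h2

omit [DecidableEq n] in
lemma smul_mem_map_leftKer {P Q : Matrix n n S} (h : ∀ v, Q *ᵥ v = 0 → ∃ w, v = P *ᵥ w) {r : S}
    {Υ : Matrix b b S} {Θ : Matrix n b S} (hr : r • 1 = Υ + u * Θ) (hu : Υ * u = 0)
    {X : Matrix n b S} (hX : X ∈ leftKer n u) (hQX : Q * X = 0) :
    r • X ∈ (leftKer n u).map (mulLeftLinearMap b S P) := by
  obtain ⟨Y, rfl⟩ := exists_eq_mul_of_mulVec h X hQX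
  refine ⟨Y * Υ, mem_leftKer.2 (by rw [Matrix.mul_assoc, hu, Matrix.mul_zero]), ?_⟩
  have h1 : P * Y * (r • (1 : Matrix b b S)) = P * Y * Υ := by
    rw [hr, Matrix.mul_add, ← Matrix.mul_assoc _ u, mem_leftKer.1 hX, Matrix.zero_mul, add_zero]
  rw [Matrix.mul_smul, Matrix.mul_one] at h1
  rw [h1, Matrix.mul_assoc]
  rfl

end Matrix.IsPeriodicResolution

/-! ### Tor computed from explicit resolutions -/

section TorHomology

variable {R : Type u} [CommRing R]

lemma CategoryTheory.ShortComplex.length_homology_moduleCat (S : ShortComplex (ModuleCat.{u} R)) :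
    Module.length R S.homology =
      (LinearMap.range S.f.hom).relLength (LinearMap.ker S.g.hom) := by
  rw [S.moduleCatHomologyIso.toLinearEquiv.length_eq, Submodule.relLength]
  have : LinearMap.range S.moduleCatToCycles =
      (LinearMap.range S.f.hom).submoduleOf (LinearMap.ker S.g.hom) := by
    ext x
    exact exists_congr fun y ↦ Subtype.ext_iff
  exact (Submodule.quotEquivOfEq _ _ this).length_eq

open MonoidalCategory in
lemma torLength_eq_of_projectiveResolution (X N : Type u) [AddCommGroup X] [Module R X]
    [AddCommGroup N] [Module R N] (P : ProjectiveResolution (ModuleCat.of R N)) (i : ℕ) :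
    torLength R (i + 1) X N =
      (LinearMap.range ((P.complex.d (i + 2) (i + 1)).hom.lTensor X)).relLength
        (LinearMap.ker ((P.complex.d (i + 1) i).hom.lTensor X)) := by
  let F := (tensoringLeft (ModuleCat.{u} R)).obj (ModuleCat.of R X)
  let K := (F.mapHomologicalComplex (ComplexShape.down ℕ)).obj P.complex
  let e1 := P.isoLeftDerivedObj F (i + 1)
  let e2 := ShortComplex.homologyMapIso (K.isoSc' (i + 2) (i + 1) i (by simp) (by simp))
  have h1 : torLength R (i + 1) X N = Module.length R (K.sc (i + 1)).homology :=
    e1.toLinearEquiv.length_eq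
  rw [h1, e2.toLinearEquiv.length_eq, ShortComplex.length_homology_moduleCat]
  rfl

/-- Projective resolutions as data of linear maps. -/
theorem ModuleCat.exists_projectiveResolution {N : Type u} [AddCommGroup N] [Module R N]
    (F : ℕ → Type u) [∀ i, AddCommGroup (F i)] [∀ i, Module R (F i)] [∀ i, Module.Projective R (F i)]
    (D : ∀ i, F (i + 1) →ₗ[R] F i) (ε : F 0 →ₗ[R] N) (hε : Function.Surjective ε)
    (h0 : Function.Exact (D 0) ε) (h : ∀ i, Function.Exact (D (i + 1)) (D i)) :
    ∃ P : ProjectiveResolution (ModuleCat.of R N), P.complex =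
      ChainComplex.of (fun i ↦ ModuleCat.of R (F i)) (fun i ↦ ModuleCat.ofHom (D i))
        (fun i ↦ ModuleCat.hom_ext (h i).linearMap_comp_eq_zero) := by
  let C := ChainComplex.of (fun i ↦ ModuleCat.of R (F i)) (fun i ↦ ModuleCat.ofHom (D i))
        (fun i ↦ ModuleCat.hom_ext (h i).linearMap_comp_eq_zero)
  have hd : ∀ i, C.d (i + 1) i = ModuleCat.ofHom (D i) := fun i ↦
    ChainComplex.of_d (fun i ↦ ModuleCat.of R (F i)) (fun i ↦ ModuleCat.ofHom (D i)) i
  let π : C ⟶ (ChainComplex.single₀ (ModuleCat R)).obj (ModuleCat.of R N) :=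
    (ChainComplex.toSingle₀Equiv C (ModuleCat.of R N)).symm ⟨ModuleCat.ofHom ε, by
      rw [hd]; exact ModuleCat.hom_ext h0.linearMap_comp_eq_zero⟩
  have hπ : π.f 0 = ModuleCat.ofHom ε := by simp [π]
  refine ⟨{ complex := C, π := π, projective := fun i ↦ ?_, quasiIso := ⟨fun i ↦ ?_⟩ }, rfl⟩
  · exact (IsProjective.iff_projective (R := R) (F i)).1 inferInstance
  · cases i with
    | zero =>
      rw [ChainComplex.quasiIsoAt₀_iff, ShortComplex.quasiIso_iff_of_zeros' _ rfl rfl rfl]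
      constructor
      · rw [ShortComplex.moduleCat_exact_iff]
        intro x hx
        have hx' : ε x = 0 := by
          have : π.f 0 x = 0 := hx
          rwa [hπ] at this
        obtain ⟨y, hy⟩ := (h0 x).1 hx'
        refine ⟨y, ?_⟩
        change C.d 1 0 y = x
        rw [hd]
        exact hy
      · change Epi (π.f 0)
        rw [hπ]
        exact (ModuleCat.epi_iff_surjective _).2 hε
    | succ i =>
      rw [quasiIsoAt_iff_exactAt' (hL := ChainComplex.exactAt_succ_single_obj ..),
        HomologicalComplex.exactAt_iff' _ (i + 2) (i + 1) i (by simp) (by simp),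
        ShortComplex.moduleCat_exact_iff]
      intro x hx
      have hx' : D i x = 0 := by
        have : C.d (i + 1) i x = 0 := hx
        rwa [hd] at this
      obtain ⟨y, hy⟩ := (h i x).1 hx'
      refine ⟨y, ?_⟩
      change C.d (i + 2) (i + 1) y = x
      rw [hd]
      exact hy

/-- `Tor` is computed by an arbitrary projective resolution of the second argument. -/
theorem torLength_eq_relLength (X : Type u) [AddCommGroup X] [Module R X] {N : Type u}
    [AddCommGroup N] [Module R N]
    (F : ℕ → Type u) [∀ i, AddCommGroup (F i)] [∀ i, Module R (F i)] [∀ i, Module.Projective R (F i)]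
    (D : ∀ i, F (i + 1) →ₗ[R] F i) (ε : F 0 →ₗ[R] N) (hε : Function.Surjective ε)
    (h0 : Function.Exact (D 0) ε) (h : ∀ i, Function.Exact (D (i + 1)) (D i)) (i : ℕ) :
    torLength R (i + 1) X N = (LinearMap.range ((D (i + 1)).lTensor X)).relLength
      (LinearMap.ker ((D i).lTensor X)) := by
  obtain ⟨P, hP⟩ := ModuleCat.exists_projectiveResolution F D ε hε h0 h
  have hd : ∀ i, (ChainComplex.of (fun i ↦ ModuleCat.of R (F i)) (fun i ↦ ModuleCat.ofHom (D i))
        (fun i ↦ ModuleCat.hom_ext (h i).linearMap_comp_eq_zero)).d (i + 1) i =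
      ModuleCat.ofHom (D i) := fun i ↦
    ChainComplex.of_d (fun i ↦ ModuleCat.of R (F i)) (fun i ↦ ModuleCat.ofHom (D i)) i
  rw [torLength_eq_of_projectiveResolution X N P i, hP, hd, hd]
  rfl

end TorHomology

/-! ### Homology lengths: transport and base change -/

section RelLengthHomology

open TensorProduct

variable {R M₁ M₂ M₃ N₁ N₂ N₃ : Type*} [CommRing R] [AddCommGroup M₁] [AddCommGroup M₂]
  [AddCommGroup M₃] [AddCommGroup N₁] [AddCommGroup N₂] [AddCommGroup N₃] [Module R M₁]
  [Module R M₂] [Module R M₃] [Module R N₁] [Module R N₂] [Module R N₃]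

lemma Submodule.relLength_bot_top : (⊥ : Submodule R M₁).relLength ⊤ = Module.length R M₁ :=
  ((Submodule.quotEquivOfEqBot _ (by
    rw [Submodule.submoduleOf, Submodule.comap_bot, Submodule.ker_subtype])).trans
      Submodule.topEquiv).length_eq

lemma LinearMap.relLength_range_top_of_exact {f : M₁ →ₗ[R] M₂} {g : M₂ →ₗ[R] M₃}
    (hfg : Function.Exact f g) (hg : Function.Surjective g) :
    (LinearMap.range f).relLength ⊤ = Module.length R M₃ := by
  rw [← LinearMap.exact_iff.1 hfg, ← Submodule.comap_bot, Submodule.relLength_comap,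
    Submodule.map_top, LinearMap.range_eq_top.2 hg, Submodule.relLength_bot_top]

lemma Submodule.relLength_congr (e : M₁ ≃ₗ[R] N₁) {Q P : Submodule R M₁} {Q' P' : Submodule R N₁}
    (hQ : ∀ x, e x ∈ Q' ↔ x ∈ Q) (hP : ∀ x, e x ∈ P' ↔ x ∈ P) :
    Q.relLength P = Q'.relLength P' := by
  have h1 : Q'.comap e.toLinearMap = Q := Submodule.ext hQ
  have h2 : P.map e.toLinearMap = P' := by
    ext x
    obtain ⟨x, rfl⟩ := e.surjective x
    rw [hP]
    exact ⟨fun ⟨y, hy, h⟩ ↦ e.injective h ▸ hy, fun h ↦ ⟨x, h, rfl⟩⟩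
  rw [← h1, relLength_comap, h2]

lemma LinearMap.relLength_range_ker_eq_homologyLength {α β : M₁ →ₗ[R] M₁} {α' β' : N₁ →ₗ[R] N₁}
    (J : M₁ →ₗ[R] N₁) (hJ : Function.Injective J) (hα : ∀ x, J (α x) = α' (J x))
    (hβ : ∀ x, J (β x) = β' (J x)) :
    (LinearMap.range β).relLength (LinearMap.ker α) =
      Submodule.homologyLength α' β' (LinearMap.range J) := by
  have h1 : (LinearMap.range β).map J = (LinearMap.range J).map β' := by
    rw [← LinearMap.range_comp, ← LinearMap.range_comp]
    congr 1
    exact LinearMap.ext hβ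
  have h2 : (LinearMap.ker α).map J = LinearMap.range J ⊓ LinearMap.ker α' := by
    ext x
    constructor
    · rintro ⟨y, hy, rfl⟩
      exact ⟨⟨y, rfl⟩, (hα y).symm.trans (by rw [LinearMap.mem_ker.1 hy, map_zero])⟩
    · rintro ⟨⟨y, rfl⟩, hy⟩
      exact ⟨y, hJ ((hα y).trans (hy.trans (map_zero J).symm)), rfl⟩
  rw [Submodule.homologyLength, ← h1, ← h2, Submodule.relLength_map_map,
    LinearMap.ker_eq_bot.2 hJ, sup_bot_eq]

variable {S : Type*} [CommRing S] [IsLocalRing R] [IsLocalRing S] [Algebra R S] [Module.Flat R S]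

/-- The length of homology is preserved under a flat base change with trivial closed fibre. -/
theorem LinearMap.relLength_range_ker_baseChange
    (hm : (maximalIdeal R).map (algebraMap R S) = maximalIdeal S) {α : M₁ →ₗ[R] M₂}
    {β : M₂ →ₗ[R] M₃} (h : β ∘ₗ α = 0) :
    (LinearMap.range (α.baseChange S)).relLength (LinearMap.ker (β.baseChange S)) =
      (LinearMap.range α).relLength (LinearMap.ker β) := by
  have hloc : IsLocalHom (algebraMap R S) :=
    ((local_hom_TFAE (algebraMap R S)).out 0 2).2 hm.le
  let α' : M₁ →ₗ[R] LinearMap.ker β := α.codRestrict _ fun x ↦ congr($h x)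
  let g := ((LinearMap.range α).submoduleOf (LinearMap.ker β)).mkQ
  have hg : Function.Surjective g := Submodule.mkQ_surjective _
  have hαg : Function.Exact α' g := by
    rw [LinearMap.exact_iff, Submodule.ker_mkQ]
    ext x
    exact exists_congr fun y ↦ (Subtype.ext_iff (a1 := α' y) (a2 := x)).symm
  let i : S ⊗[R] LinearMap.ker β →ₗ[S] S ⊗[R] M₂ := (LinearMap.ker β).subtype.baseChange S
  have hi : Function.Injective i :=
    Module.Flat.lTensor_preserves_injective_linearMap (M := S) _ (Submodule.injective_subtype _)
  have hex : Function.Exact i (β.baseChange S) :=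
    Module.Flat.lTensor_exact S (LinearMap.exact_subtype_ker_map β)
  -- Flat local base change multiplies lengths by the length of the closed fibre, which here is a
  -- field.
  have hlen : Module.length S (S ⧸ (maximalIdeal R).map (algebraMap R S)) = 1 := by
    rw [hm, Module.length_eq_one_iff, isSimpleModule_iff_isCoatom]
    exact (maximalIdeal.isMaximal S).out
  have h1 : (LinearMap.range (α'.baseChange S)).relLength ⊤ = (LinearMap.range α).relLength
      (LinearMap.ker β) := by
    rw [LinearMap.relLength_range_top_of_exact (g := g.baseChange S)
      (_root_.lTensor_exact S hαg hg) (LinearMap.lTensor_surjective S hg),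
      IsLocalRing.length_baseChange, hlen, mul_one]
    rfl
  rw [← h1, LinearMap.exact_iff.1 hex,
    show α.baseChange S = i ∘ₗ α'.baseChange S from by
      rw [← LinearMap.baseChange_comp]; rfl,
    LinearMap.range_comp, ← Submodule.map_top i, Submodule.relLength_map_map, LinearMap.ker_eq_bot.2 hi, sup_bot_eq]

end RelLengthHomology

/-! ### Invariance of the lengths of Tor under base change -/

section TorBaseChange

open TensorProduct

variable {R S : Type u} [CommRing R] [CommRing S] [IsLocalRing R] [IsLocalRing S] [Algebra R S]
  [Module.Flat R S]

lemma exists_projective_resolution_data (N : Type u) [AddCommGroup N] [Module R N] :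
    ∃ (F : ℕ → Type u) (_ : ∀ i, AddCommGroup (F i)) (_ : ∀ i, Module R (F i))
      (_ : ∀ i, Module.Projective R (F i)) (D : ∀ i, F (i + 1) →ₗ[R] F i) (ε : F 0 →ₗ[R] N),
      Function.Surjective ε ∧ Function.Exact (D 0) ε ∧
        ∀ i, Function.Exact (D (i + 1)) (D i) := by
  let P := projectiveResolution (ModuleCat.of R N)
  have hε : Function.Surjective (P.π.f 0).hom :=
    (ModuleCat.epi_iff_surjective (P.π.f 0)).1 inferInstance
  exact ⟨fun i ↦ P.complex.X i, fun i ↦ inferInstance, fun i ↦ inferInstance,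
    fun i ↦ (IsProjective.iff_projective (R := R) (P.complex.X i)).2 (P.projective i),
    fun i ↦ (P.complex.d (i + 1) i).hom, (P.π.f 0).hom, hε,
    (ShortComplex.ShortExact.moduleCat_exact_iff_function_exact _).1 P.exact₀,
    fun i ↦ (ShortComplex.ShortExact.moduleCat_exact_iff_function_exact _).1 (P.exact_succ i)⟩

lemma LinearMap.distribBaseChange_baseChange_lTensor (X : Type*) {F G : Type*} [AddCommGroup X]
    [Module R X] [AddCommGroup F] [Module R F] [AddCommGroup G] [Module R G] (D : F →ₗ[R] G)
    (x : S ⊗[R] (X ⊗[R] F)) :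
    AlgebraTensorModule.distribBaseChange R S X G ((D.lTensor X).baseChange S x) =
      (D.baseChange S).lTensor (S ⊗[R] X) (AlgebraTensorModule.distribBaseChange R S X F x) := by
  induction x with
  | zero => simp only [map_zero]
  | add x y hx hy => simp only [map_add, hx, hy]
  | tmul s x =>
    induction x with
    | zero => simp only [tmul_zero, map_zero]
    | add x y hx hy => simp only [tmul_add, map_add, hx, hy]
    | tmul x y => rfl

lemma LinearMap.relLength_range_ker_lTensor_baseChange
    (hm : (maximalIdeal R).map (algebraMap R S) = maximalIdeal S) (X : Type*) {F₁ F₂ F₃ : Type*}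
    [AddCommGroup X] [Module R X] [AddCommGroup F₁] [Module R F₁] [AddCommGroup F₂] [Module R F₂]
    [AddCommGroup F₃] [Module R F₃] {α : F₁ →ₗ[R] F₂} {β : F₂ →ₗ[R] F₃} (h : β ∘ₗ α = 0) :
    Submodule.relLength (R := S) (M := (S ⊗[R] X) ⊗[S] (S ⊗[R] F₂))
        (LinearMap.range ((α.baseChange S).lTensor (S ⊗[R] X)))
        (LinearMap.ker ((β.baseChange S).lTensor (S ⊗[R] X))) =
      (LinearMap.range (α.lTensor X)).relLength (LinearMap.ker (β.lTensor X)) := by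
  have hzero : β.lTensor X ∘ₗ α.lTensor X = 0 := by
    rw [← LinearMap.lTensor_comp, h, LinearMap.lTensor_zero]
  refine Eq.trans (Eq.symm ?_) (LinearMap.relLength_range_ker_baseChange hm hzero)
  refine Submodule.relLength_congr (AlgebraTensorModule.distribBaseChange R S X F₂) (fun x ↦ ?_)
    fun x ↦ ?_
  · constructor
    · rintro ⟨y, hy⟩
      obtain ⟨y, rfl⟩ := (AlgebraTensorModule.distribBaseChange R S X F₁).surjective y
      rw [← LinearMap.distribBaseChange_baseChange_lTensor] at hy
      exact ⟨y, LinearEquiv.injective _ hy⟩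
    · rintro ⟨y, rfl⟩
      rw [LinearMap.distribBaseChange_baseChange_lTensor]
      exact ⟨_, rfl⟩
  · rw [LinearMap.mem_ker, LinearMap.mem_ker, ← LinearMap.distribBaseChange_baseChange_lTensor]
    exact (AlgebraTensorModule.distribBaseChange R S X F₃).map_eq_zero_iff

lemma Function.Exact.baseChange_of_flat {M₁ M₂ M₃ : Type*} [AddCommGroup M₁] [Module R M₁]
    [AddCommGroup M₂] [Module R M₂] [AddCommGroup M₃] [Module R M₃] {f : M₁ →ₗ[R] M₂}
    {g : M₂ →ₗ[R] M₃} (h : Function.Exact f g) :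
    Function.Exact (f.baseChange S) (g.baseChange S) :=
  Module.Flat.lTensor_exact S h

lemma torLength_baseChange_of_resolution
    (hm : (maximalIdeal R).map (algebraMap R S) = maximalIdeal S) (X : Type u) {N : Type u}
    [AddCommGroup X] [Module R X] [AddCommGroup N] [Module R N] (F : ℕ → Type u)
    [∀ i, AddCommGroup (F i)] [∀ i, Module R (F i)] [∀ i, Module.Projective R (F i)]
    (D : ∀ i, F (i + 1) →ₗ[R] F i) (ε : F 0 →ₗ[R] N) (hε : Function.Surjective ε)
    (h0 : Function.Exact (D 0) ε) (hD : ∀ i, Function.Exact (D (i + 1)) (D i)) (i : ℕ) :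
    torLength S (i + 1) (S ⊗[R] X) (S ⊗[R] N) = torLength R (i + 1) X N := by
  have e0 : Function.Exact ((D 0).baseChange S) (ε.baseChange S) := h0.baseChange_of_flat
  have eD : ∀ i, Function.Exact ((D (i + 1)).baseChange S) ((D i).baseChange S) :=
    fun i ↦ (hD i).baseChange_of_flat
  have eε : Function.Surjective (ε.baseChange S) := LinearMap.lTensor_surjective S hε
  have key := @torLength_eq_relLength S _ (S ⊗[R] X) _ _ (S ⊗[R] N) _ _ (fun i ↦ S ⊗[R] F i)
    (fun _ ↦ inferInstance) (fun _ ↦ inferInstance) (fun _ ↦ inferInstance)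
  replace key := key (fun i ↦ (D i).baseChange S) (ε.baseChange S) eε e0 eD i
  rw [torLength_eq_relLength X F D ε hε h0 hD i, key,
    LinearMap.relLength_range_ker_lTensor_baseChange hm X (hD i).linearMap_comp_eq_zero]

theorem torLength_baseChange (hm : (maximalIdeal R).map (algebraMap R S) = maximalIdeal S)
    (X N : Type u) [AddCommGroup X] [Module R X] [AddCommGroup N] [Module R N] (i : ℕ) :
    torLength S (i + 1) (S ⊗[R] X) (S ⊗[R] N) = torLength R (i + 1) X N := by
  obtain ⟨F, _, _, _, D, ε, hε, h0, hD⟩ := exists_projective_resolution_data (R := R) N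
  exact torLength_baseChange_of_resolution hm X F D ε hε h0 hD i

end TorBaseChange

/-! ### Tor against a module with a two-periodic resolution -/

section TorPeriodic

open Matrix TensorProduct

variable {S : Type u} [CommRing S] {b n : ℕ}

/-- The ranks in a free resolution that is two-periodic from degree one on. -/
def periodicRank (b n : ℕ) : ℕ → ℕ
  | 0 => b
  | _ + 1 => n

/-- The differentials in a free resolution that is two-periodic from degree one on. -/
def periodicDifferential (A B : Matrix (Fin n) (Fin n) S) (u : Matrix (Fin b) (Fin n) S) :
    ∀ i, (Fin (periodicRank b n (i + 1)) → S) →ₗ[S] (Fin (periodicRank b n i) → S)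
  | 0 => u.mulVecLin
  | k + 1 => if Even k then A.mulVecLin else B.mulVecLin

variable {A B : Matrix (Fin n) (Fin n) S} {u : Matrix (Fin b) (Fin n) S}

lemma Matrix.IsPeriodicResolution.exact_periodicDifferential (h : IsPeriodicResolution A B u)
    (i : ℕ) : Function.Exact (periodicDifferential A B u (i + 1)) (periodicDifferential A B u i) := by
  have aux : ∀ {l : ℕ} {P : Matrix (Fin l) (Fin n) S} {Q : Matrix (Fin n) (Fin n) S}, P * Q = 0 →
      (∀ v, P *ᵥ v = 0 → ∃ w, v = Q *ᵥ w) → Function.Exact Q.mulVecLin P.mulVecLin := by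
    intro l P Q hPQ h v
    refine ⟨fun hv ↦ ?_, ?_⟩
    · obtain ⟨w, rfl⟩ := h v hv
      exact ⟨w, rfl⟩
    · rintro ⟨w, rfl⟩
      rw [mulVecLin_apply, mulVecLin_apply, mulVec_mulVec, hPQ, zero_mulVec]
  cases i with
  | zero => exact aux h.mul_eq_zero_u h.exact_u
  | succ k =>
    by_cases hk : Even k
    · have h1 : periodicDifferential A B u (k + 1) = A.mulVecLin := if_pos hk
      have h2 : periodicDifferential A B u (k + 2) = B.mulVecLin :=
        if_neg (by simpa [Nat.even_add_one] using hk)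
      rw [h1, h2]
      exact aux h.mul_eq_zero h.exact_left
    · have h1 : periodicDifferential A B u (k + 1) = B.mulVecLin := if_neg hk
      have h2 : periodicDifferential A B u (k + 2) = A.mulVecLin :=
        if_pos (by simpa [Nat.even_add_one] using hk)
      rw [h1, h2]
      exact aux h.mul_eq_zero' h.exact_left'

/-- The coordinates of functionals on the image of `p` that are induced by row vectors. -/
lemma Matrix.exists_injective_of_dual {N X : Type*} [AddCommGroup N] [Module S N] [AddCommGroup X]
    [Module S X] {p : (Fin b → S) →ₗ[S] N} (hp : Function.Surjective p)
    (hpu : LinearMap.ker p = LinearMap.range u.mulVecLin) (e : X ≃ₗ[S] Module.Dual S N) :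
    ∃ j : X →ₗ[S] (Fin b → S), Function.Injective j ∧ ∀ w, w ∈ LinearMap.range j ↔ w ᵥ* u = 0 := by
  let j : X →ₗ[S] (Fin b → S) :=
    LinearMap.pi fun i ↦ LinearMap.applyₗ (p (Pi.single i 1)) ∘ₗ e.toLinearMap
  have hj : ∀ x v, e x (p v) = j x ⬝ᵥ v := fun x v ↦ by
    have h1 : v = ∑ i, v i • (Pi.single i 1 : Fin b → S) := by
      ext k; simp [Finset.sum_apply, Pi.single_apply]
    conv_lhs => rw [h1]
    simp [j, dotProduct, mul_comm]
  refine ⟨j, fun x y hxy ↦ e.injective (LinearMap.ext fun z ↦ ?_), fun w ↦ ⟨?_, fun hw ↦ ?_⟩⟩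
  · obtain ⟨v, rfl⟩ := hp z
    rw [hj, hj, hxy]
  · rintro ⟨x, rfl⟩
    ext k
    have h1 : p (u *ᵥ Pi.single k 1) = 0 := by
      rw [← LinearMap.mem_ker, hpu]; exact ⟨_, rfl⟩
    have h2 := hj x (u *ᵥ Pi.single k 1)
    rw [h1, map_zero, dotProduct_mulVec, dotProduct_single_one] at h2
    exact h2.symm
  · let ω : (Fin b → S) →ₗ[S] S :=
      { toFun := fun v ↦ w ⬝ᵥ v
        map_add' := dotProduct_add w
        map_smul' := fun r v ↦ dotProduct_smul r w v }
    have hle : LinearMap.ker p ≤ LinearMap.ker ω := by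
      rw [hpu]
      rintro _ ⟨v, rfl⟩
      change w ⬝ᵥ (u *ᵥ v) = 0
      rw [dotProduct_mulVec, hw, zero_dotProduct]
    let ξ : Module.Dual S N :=
      (LinearMap.ker p).liftQ ω hle ∘ₗ (p.quotKerEquivOfSurjective hp).symm.toLinearMap
    have hξ : ∀ v, ξ (p v) = w ⬝ᵥ v := fun v ↦ by
      have h1 : (p.quotKerEquivOfSurjective hp).symm (p v) = Submodule.Quotient.mk v := by
        rw [LinearEquiv.symm_apply_eq]; rfl
      simp only [ξ, LinearMap.comp_apply, LinearEquiv.coe_coe, h1]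
      rfl
    refine ⟨e.symm ξ, funext fun i ↦ ?_⟩
    change e (e.symm ξ) (p (Pi.single i 1)) = w i
    rw [e.apply_symm_apply, hξ, dotProduct_single_one]

/-- With `X = N*` embedded in `Sᵇ` as the row vectors killed by `u`, the module `X ⊗ Sⁿ` becomes the
`n × b` matrices `w` with `w u = 0`, and the differentials become left multiplications. -/
theorem Matrix.IsPeriodicResolution.relLength_lTensor_eq_homologyLength {X : Type*}
    [AddCommGroup X] [Module S X] (j : X →ₗ[S] (Fin b → S)) (hj : Function.Injective j)
    (hju : ∀ w, w ∈ LinearMap.range j ↔ w ᵥ* u = 0) (A B : Matrix (Fin n) (Fin n) S) :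
    (LinearMap.range (B.mulVecLin.lTensor X)).relLength (LinearMap.ker (A.mulVecLin.lTensor X)) =
      Submodule.homologyLength (mulLeftLinearMap (Fin b) S A) (mulLeftLinearMap (Fin b) S B)
        (leftKer (Fin n) u) := by
  let J : X ⊗[S] (Fin n → S) →ₗ[S] Matrix (Fin n) (Fin b) S :=
    (Matrix.ofLinearEquiv S).toLinearMap ∘ₗ j.compLeft (Fin n) ∘ₗ
      (TensorProduct.piScalarRight S S X (Fin n)).toLinearMap
  have hJt : ∀ x v i k, J (x ⊗ₜ v) i k = v i * j x k := fun x v i k ↦ by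
    simp [J]
  have hJ : Function.Injective J := fun x y hxy ↦
    (TensorProduct.piScalarRight S S X (Fin n)).injective
      (funext fun i ↦ hj (congrFun ((Matrix.ofLinearEquiv S).injective hxy) i))
  have hmul : ∀ (C : Matrix (Fin n) (Fin n) S) x,
      J (C.mulVecLin.lTensor X x) = mulLeftLinearMap (Fin b) S C (J x) := fun C x ↦ by
    induction x with
    | zero => simp only [map_zero]
    | add x y hx hy => simp only [map_add, hx, hy]
    | tmul x v =>
      ext i k
      rw [LinearMap.lTensor_tmul, hJt]
      simp [Matrix.mul_apply, hJt, mulVec, dotProduct, Finset.sum_mul, mul_assoc]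
  have hrange : LinearMap.range J = leftKer (Fin n) u := by
    ext w
    rw [mem_leftKer]
    constructor
    · rintro ⟨x, rfl⟩
      ext i k
      exact congrFun ((hju _).1 ⟨TensorProduct.piScalarRight S S X (Fin n) x i, rfl⟩) k
    · intro hw
      choose x hx using fun i ↦ (hju (w i)).2 (funext fun k ↦ congrFun (congrFun hw i) k)
      refine ⟨(TensorProduct.piScalarRight S S X (Fin n)).symm x, ?_⟩
      ext i k
      simp [J, hx]
  rw [← hrange]
  exact LinearMap.relLength_range_ker_eq_homologyLength J hJ (hmul A) (hmul B)

/-- Even and odd `Tor` modules against a module with a two-periodic resolution. -/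
theorem Matrix.IsPeriodicResolution.torLength_eq (h : IsPeriodicResolution A B u) {N X : Type u}
    [AddCommGroup N] [Module S N] [AddCommGroup X] [Module S X] {p : (Fin b → S) →ₗ[S] N}
    (hp : Function.Surjective p) (hpu : LinearMap.ker p = LinearMap.range u.mulVecLin)
    (e : X ≃ₗ[S] Module.Dual S N) {k : ℕ} (hk : Even k) :
    torLength S (k + 2) X N = Submodule.homologyLength (mulLeftLinearMap (Fin b) S A)
        (mulLeftLinearMap (Fin b) S B) (leftKer (Fin n) u) ∧
    torLength S (k + 3) X N = Submodule.homologyLength (mulLeftLinearMap (Fin b) S B)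
        (mulLeftLinearMap (Fin b) S A) (leftKer (Fin n) u) := by
  obtain ⟨j, hj, hju⟩ := exists_injective_of_dual hp hpu e
  have hodd : ¬ Even (k + 1) := by simpa [Nat.even_add_one] using hk
  have heven : Even (k + 2) := by simpa [Nat.even_add_one] using hk
  have htor := torLength_eq_relLength X (fun i ↦ Fin (periodicRank b n i) → S)
    (periodicDifferential A B u) p hp (LinearMap.exact_iff.2 hpu) h.exact_periodicDifferential
  constructor
  · rw [htor (k + 1)]
    have h1 : periodicDifferential A B u (k + 1) = A.mulVecLin := if_pos hk
    have h2 : periodicDifferential A B u (k + 2) = B.mulVecLin := if_neg hodd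
    rw [h1, h2]
    exact relLength_lTensor_eq_homologyLength j hj hju A B
  · rw [htor (k + 2)]
    have h1 : periodicDifferential A B u (k + 2) = B.mulVecLin := if_neg hodd
    have h2 : periodicDifferential A B u (k + 3) = A.mulVecLin := if_pos heven
    rw [h1, h2]
    exact relLength_lTensor_eq_homologyLength j hj hju B A

end TorPeriodic

/-! ### Minimal covers over the completion and the conclusion -/

section Conclusion

open Matrix TensorProduct RingTheory.Sequence

/-- Every finite module over a local ring has a minimal free cover. -/
theorem IsLocalRing.exists_minimal_cover (R : Type*) [CommRing R] [IsLocalRing R] (N : Type*)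
    [AddCommGroup N] [Module R N] [Module.Finite R N] :
    ∃ (b : ℕ) (p : (Fin b → R) →ₗ[R] N), Function.Surjective p ∧
      ∀ x, p x = 0 → ∀ i, x i ∈ maximalIdeal R := by
  let w := Module.finBasis (ResidueField R) (ResidueField R ⊗[R] N)
  obtain ⟨v, hv⟩ := (TensorProduct.mk_surjective R N (ResidueField R)
    Ideal.Quotient.mk_surjective).comp_left w
  have hv' : ∀ i, (1 : ResidueField R) ⊗ₜ[R] v i = w i := congr_fun hv
  refine ⟨_, Fintype.linearCombination R v, ?_, fun x hx i ↦ ?_⟩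
  · rw [← LinearMap.range_eq_top, Fintype.range_linearCombination]
    exact span_eq_top_of_tmul_eq_basis v w hv'
  · have h1 : ∑ i, residue R (x i) • w i = 0 := by
      have : (1 : ResidueField R) ⊗ₜ[R] (Fintype.linearCombination R v x) = 0 := by
        rw [hx, tmul_zero]
      rw [Fintype.linearCombination_apply, tmul_sum] at this
      rw [← this]
      refine Finset.sum_congr rfl fun i _ ↦ ?_
      rw [tmul_smul, hv', ← algebraMap_smul (ResidueField R) (x i) (w i)]
      rfl
    exact (residue_eq_zero_iff _).1 (Fintype.linearIndependent_iff.1 w.linearIndependent _ h1 i)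

/-- The base change of a free cover in coordinates. -/
noncomputable def freeCoverBaseChange {R : Type*} (S : Type*) [CommRing R] [CommRing S]
    [Algebra R S] {N : Type*} [AddCommGroup N] [Module R N] {b : ℕ} (p : (Fin b → R) →ₗ[R] N) :
    (Fin b → S) →ₗ[S] S ⊗[R] N :=
  p.baseChange S ∘ₗ (TensorProduct.piScalarRight R S S (Fin b)).symm.toLinearMap

lemma injective_of_freeCoverBaseChange {R S N : Type*} [CommRing R] [CommRing S] [Algebra R S]
    [Module.FaithfullyFlat R S] [AddCommGroup N] [Module R N] {b : ℕ} {p : (Fin b → R) →ₗ[R] N}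
    (h : LinearMap.ker (freeCoverBaseChange S p) = ⊥) : Function.Injective p := by
  rw [injective_iff_map_eq_zero]
  intro x hx
  refine Module.FaithfullyFlat.tensorProduct_mk_injective (A := R) (B := S) (Fin b → R) ?_
  have h1 : TensorProduct.piScalarRight R S S (Fin b) ((1 : S) ⊗ₜ[R] x) ∈
      LinearMap.ker (freeCoverBaseChange S p) := by
    simp [freeCoverBaseChange, hx, -TensorProduct.piScalarRight_apply]
  rw [h, Submodule.mem_bot, LinearEquiv.map_eq_zero_iff] at h1
  simpa using h1

variable {R S T : Type u} [CommRing R] [IsLocalRing R] [IsNoetherianRing R] [CommRing S]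
  [IsLocalRing S] [IsNoetherianRing S] [Algebra R S] [Module.Flat R S] [CommRing T]
  [IsRegularLocalRing T] [Algebra T S] {f : T}

section FreeCover

variable {N : Type*} [AddCommGroup N] [Module R N] {b : ℕ} {p : (Fin b → R) →ₗ[R] N}

lemma freeCoverBaseChange_surjective (hp : Function.Surjective p) :
    Function.Surjective (freeCoverBaseChange S p) :=
  (LinearMap.lTensor_surjective S hp).comp (LinearEquiv.surjective _)

lemma ker_freeCoverBaseChange : LinearMap.ker (freeCoverBaseChange S p) =
    LinearMap.range ((TensorProduct.piScalarRight R S S (Fin b)).toLinearMap ∘ₗ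
      (LinearMap.ker p).subtype.baseChange S) := by
  have h : Function.Exact ((LinearMap.ker p).subtype.baseChange S) (p.baseChange S) :=
    Module.Flat.lTensor_exact S (LinearMap.exact_subtype_ker_map p)
  ext x
  constructor
  · intro hx
    obtain ⟨y, hy⟩ := (h _).1 hx
    exact ⟨y, (LinearEquiv.eq_symm_apply _).1 hy⟩
  · rintro ⟨y, rfl⟩
    change p.baseChange S ((TensorProduct.piScalarRight R S S (Fin b)).symm
      (TensorProduct.piScalarRight R S S (Fin b) ((LinearMap.ker p).subtype.baseChange S y))) = 0
    rw [LinearEquiv.symm_apply_apply]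
    exact h.apply_apply_eq_zero y

lemma mem_maximalIdeal_of_mem_ker_freeCoverBaseChange
    (hm : (maximalIdeal R).map (algebraMap R S) = maximalIdeal S)
    (hmin : ∀ x, p x = 0 → ∀ i, x i ∈ maximalIdeal R) {x : Fin b → S}
    (hx : x ∈ LinearMap.ker (freeCoverBaseChange S p)) (i : Fin b) : x i ∈ maximalIdeal S := by
  rw [ker_freeCoverBaseChange] at hx
  obtain ⟨y, rfl⟩ := hx
  induction y with
  | zero => simp
  | add y z hy hz => simpa only [map_add, Pi.add_apply] using Ideal.add_mem _ hy hz
  | tmul s y =>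
    have : algebraMap R S ((y : Fin b → R) i) ∈ maximalIdeal S := by
      rw [← hm]; exact Ideal.mem_map_of_mem _ (hmin y y.2 i)
    simpa [Algebra.smul_def] using Ideal.mul_mem_right s _ this

lemma exists_extension_freeCoverBaseChange
    (h : ∀ φ : LinearMap.ker p →ₗ[R] N, ∃ ψ : (Fin b → R) →ₗ[R] N,
      ψ ∘ₗ (LinearMap.ker p).subtype = φ)
    (φ : LinearMap.ker (freeCoverBaseChange S p) →ₗ[S] S ⊗[R] N) :
    ∃ ψ : (Fin b → S) →ₗ[S] S ⊗[R] N,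
      ψ ∘ₗ (LinearMap.ker (freeCoverBaseChange S p)).subtype = φ := by
  let s := (TensorProduct.piScalarRight R S S (Fin b)).toLinearMap ∘ₗ
      (LinearMap.ker p).subtype.baseChange S
  have hs : LinearMap.ker (freeCoverBaseChange S p) = LinearMap.range s := ker_freeCoverBaseChange
  let s' : S ⊗[R] LinearMap.ker p →ₗ[S] LinearMap.ker (freeCoverBaseChange S p) :=
    s.codRestrict _ fun x ↦ hs ▸ ⟨x, rfl⟩
  obtain ⟨ψ, hψ⟩ := LinearMap.exists_extension_baseChange p h (φ ∘ₗ s')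
  refine ⟨ψ ∘ₗ (TensorProduct.piScalarRight R S S (Fin b)).symm.toLinearMap,
    LinearMap.ext fun ⟨x, hx⟩ ↦ ?_⟩
  obtain ⟨y, rfl⟩ : x ∈ LinearMap.range s := hs ▸ hx
  have h1 : ψ ((LinearMap.ker p).subtype.baseChange S y) = φ (s' y) := congr($hψ y)
  refine Eq.trans ?_ h1
  change ψ ((TensorProduct.piScalarRight R S S (Fin b)).symm
    (TensorProduct.piScalarRight R S S (Fin b) ((LinearMap.ker p).subtype.baseChange S y))) = _
  rw [LinearEquiv.symm_apply_apply]

end FreeCover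

variable {N : Type u} [AddCommGroup N] [Module R N] [Module.Finite R N]

/-- The kernel of a free cover of a reflexive module becomes a matrix factorization after base
change to a hypersurface of dimension three. -/
theorem exists_isPeriodicResolution_freeCoverBaseChange [Module.IsReflexive R N]
    (hd : ringKrullDim T = 4)
    (hπ : Function.Surjective (algebraMap T S))
    (hker : RingHom.ker (algebraMap T S) = Ideal.span {f}) (hf : f ≠ 0) {b : ℕ}
    (p : (Fin b → R) →ₗ[R] N) (hp : Function.Surjective p) :
    ∃ (n : ℕ) (A B : Matrix (Fin n) (Fin n) T) (u : Matrix (Fin b) (Fin n) S),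
      A * B = f • 1 ∧ B * A = f • 1 ∧
      LinearMap.ker (freeCoverBaseChange S p) = LinearMap.range u.mulVecLin ∧
      IsPeriodicResolution (A.map (algebraMap T S)) (B.map (algebraMap T S)) u := by
  obtain ⟨F, G, _, _, _, _, _, _, _, _, ι, δ, hι, hδ⟩ := Module.IsReflexive.exists_exact (R := R) N
  let eF := (Module.finBasis S (S ⊗[R] F)).equivFun
  let eG := (Module.finBasis S (S ⊗[R] G)).equivFun
  have hιS : Function.Injective (ι.baseChange S) :=
    Module.Flat.lTensor_preserves_injective_linearMap (M := S) _ hι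
  have hδS : Function.Exact (ι.baseChange S) (δ.baseChange S) := Module.Flat.lTensor_exact S hδ
  let p' := eF.toLinearMap ∘ₗ ι.baseChange S ∘ₗ freeCoverBaseChange S p
  let δ' := eG.toLinearMap ∘ₗ δ.baseChange S ∘ₗ eF.symm.toLinearMap
  have hex : Function.Exact p' δ' := fun x ↦ by
    constructor
    · intro hx
      obtain ⟨y, hy⟩ := (hδS (eF.symm x)).1 (eG.map_eq_zero_iff.1 hx)
      obtain ⟨z, rfl⟩ := freeCoverBaseChange_surjective (S := S) hp y
      exact ⟨z, ((LinearEquiv.eq_symm_apply _).1 hy)⟩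
    · rintro ⟨y, rfl⟩
      have : eF.symm (p' y) = ι.baseChange S (freeCoverBaseChange S p y) :=
        eF.symm_apply_apply _
      change eG (δ.baseChange S (eF.symm (p' y))) = 0
      rw [this, hδS.apply_apply_eq_zero, map_zero]
  have hkerp : LinearMap.ker p' = LinearMap.ker (freeCoverBaseChange S p) := by
    rw [LinearMap.ker_comp_of_ker_eq_bot _ (LinearEquiv.ker eF),
      LinearMap.ker_comp_of_ker_eq_bot _ (LinearMap.ker_eq_bot.2 hιS)]
  rw [← hkerp]
  exact exists_isPeriodicResolution hd hπ hker hf p' δ' hex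

/-- The dual commutes with flat base change. -/
noncomputable def Module.Dual.baseChangeEquiv (R S N : Type*) [CommRing R] [IsNoetherianRing R]
    [CommRing S] [Algebra R S] [Module.Flat R S] [AddCommGroup N] [Module R N] [Module.Finite R N] :
    S ⊗[R] Module.Dual R N ≃ₗ[S] Module.Dual S (S ⊗[R] N) :=
  have : Module.FinitePresentation R N := Module.finitePresentation_of_finite R N
  (Module.FinitePresentation.isBaseChange_map R N R S).equiv ≪≫ₗ
    LinearEquiv.congrRight (TensorProduct.AlgebraTensorModule.rid R S S)

/-- Vanishing of theta together with rigidity of the endomorphism module forces freeness. -/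
theorem free_of_torLength_eq [Module.IsReflexive R N]
    (hm : (maximalIdeal R).map (algebraMap R S) = maximalIdeal S)
    (hπ : Function.Surjective (algebraMap T S))
    (hker : RingHom.ker (algebraMap T S) = Ideal.span {f}) (hfm : f ∈ maximalIdeal T) (hf : f ≠ 0)
    (hd : ringKrullDim R = (3 : ℕ)) (hfree : IsLocallyFreeOnPuncturedSpectrum R N)
    (hMCM : IsMaximalCohenMacaulay R (N →ₗ[R] N)) {k : ℕ} (hk : Even k)
    (hθ : (torLength R (k + 4) (Module.Dual R N) N).toNat =
      (torLength R (k + 3) (Module.Dual R N) N).toNat) : Module.Free R N := by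
  have hdS : ringKrullDim S = (3 : ℕ) := (ringKrullDim_eq_of_map_maximalIdeal hm).trans hd
  have hdT : ringKrullDim T = 4 :=
    IsRegularLocalRing.ringKrullDim_eq_of_hypersurface hπ hker hfm hf hdS
  have hff := faithfullyFlat_of_map_maximalIdeal hm
  obtain ⟨rs, hrslen, hrsm, hrs⟩ := exists_isWeaklyRegular_of_hypersurface hm hπ hker hfm hf hd
  obtain ⟨ts, htslen, htsm, hts⟩ := exists_isWeaklyRegular_of_isMaximalCohenMacaulay hMCM hd
  obtain ⟨b, p, hp, hmin⟩ := IsLocalRing.exists_minimal_cover R N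
  have hextR := exists_extension_of_extVanishes hfree (by omega) hrsm hrs
    ((ExtVanishes.of_isWeaklyRegular ts htsm hts).mono htslen) p hp
  obtain ⟨l, hl⟩ := hfree.exists_comp_eq_smul p hp
  obtain ⟨n, A, B, u, hAB, hBA, hpu, h⟩ :=
    exists_isPeriodicResolution_freeCoverBaseChange (S := S) hdT hπ hker hf p hp
  have hpS := freeCoverBaseChange_surjective (S := S) hp
  have hhtpy : ∀ r ∈ maximalIdeal R ^ l, ∃ (Υ : Matrix (Fin b) (Fin b) S)
      (Θ : Matrix (Fin n) (Fin b) S), algebraMap R S r • 1 = Υ + u * Θ ∧ Υ * u = 0 := by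
    intro r hr
    obtain ⟨σ, hσ⟩ := hl r hr
    refine IsPeriodicResolution.exists_smul_eq_add hpu
      ((TensorProduct.piScalarRight R S S (Fin b)).toLinearMap ∘ₗ σ.baseChange S) ?_
    refine TensorProduct.AlgebraTensorModule.curry_injective
      (LinearMap.ext fun s ↦ LinearMap.ext fun x ↦ ?_)
    have h1 : p (σ x) = r • x := congr($hσ x)
    simp [freeCoverBaseChange, h1, -TensorProduct.piScalarRight_apply]
  have hhom : ∀ {P Q : Matrix (Fin n) (Fin n) S}, (∀ v, Q *ᵥ v = 0 → ∃ w, v = P *ᵥ w) →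
      Submodule.homologyLength (mulLeftLinearMap (Fin b) S Q) (mulLeftLinearMap (Fin b) S P)
        (leftKer (Fin n) u) ≠ ⊤ := fun hPQ ↦
    Submodule.relLength_ne_top_of_smul_mem hm l fun r hr X hX ↦ by
      obtain ⟨Υ, Θ, hr, hu⟩ := hhtpy r hr
      exact IsPeriodicResolution.smul_mem_map_leftKer hPQ hr hu hX.1 hX.2
  -- Degree `k + 3` is read off at `k`, and degree `k + 4` at the even number `k + 2`.
  have htor := (h.torLength_eq hpS hpu (Module.Dual.baseChangeEquiv R S N) hk).2
  have htor' := (h.torLength_eq hpS hpu (Module.Dual.baseChangeEquiv R S N) (hk.add even_two)).1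
  rw [torLength_baseChange hm] at htor htor'
  have hu : u = 0 := by
    refine eq_zero_of_ext_eq_zero_of_theta_eq_zero h
      (h.exists_eq_mul_add_mul hpS hpu (exists_extension_freeCoverBaseChange hextR))
      (exists_eq_mul_mul_of_shift hπ hker (mem_nonZeroDivisors_of_ne_zero hf) hAB) ?_ ?_
      (hhom h.exact_left') fun i j ↦ ?_
    · refine Submodule.relLength_ne_top_of_smul_mem hm l fun r hr X hX ↦ ?_
      obtain ⟨Υ, Θ, hr, hu⟩ := hhtpy r hr
      exact h.smul_mem_range_mulRight hr hu hX
    -- Theta only compares `toNat` values; finiteness of both lengths makes this an equality in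
    -- `ℕ∞`.
    · rw [htor', htor] at hθ
      rw [← ENat.natCast_toNat (hhom h.exact_left), ← ENat.natCast_toNat (hhom h.exact_left'), hθ]
    · have : u *ᵥ Pi.single j 1 ∈ LinearMap.ker (freeCoverBaseChange S p) := hpu ▸ ⟨_, rfl⟩
      simpa using mem_maximalIdeal_of_mem_ker_freeCoverBaseChange hm hmin this i
  have hinj : Function.Injective p := injective_of_freeCoverBaseChange (S := S) (by
    rw [hpu, hu, Matrix.mulVecLin_zero, LinearMap.range_zero])
  exact Module.Free.of_equiv (LinearEquiv.ofBijective p ⟨hinj, hp⟩)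

end Conclusion

theorem mainTheorem7 (R : Type u) [CommRing R] [IsLocalRing R] [IsNoetherianRing R]
    (hR : IsLocalHypersurface R) (hdim : ringKrullDim R = 3)
    (N : Type u) [AddCommGroup N] [Module R N] [Module.Finite R N] [Nontrivial N]
    (hrefl : Module.IsReflexive R N)
    (hfree : IsLocallyFreeOnPuncturedSpectrum R N)
    (e : ℕ) (he : ringKrullDim R ≤ ((2 * e : ℕ) : WithBot ℕ∞))
    (hθ : hochsterTheta R e (Module.Dual R N) N = 0) :
    IsMaximalCohenMacaulay R (N →ₗ[R] N) ↔ Module.Free R N := by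
  obtain ⟨T, _, _, f, -, hfm, hf, ⟨φ⟩⟩ := hR
  let S := AdicCompletion (maximalIdeal R) R
  have : IsNoetherianRing S := isNoetherianRing_of_ringEquiv (T ⧸ Ideal.span {f}) φ.symm
  let π : T →+* S := (φ.symm : (T ⧸ Ideal.span {f}) →+* S).comp (Ideal.Quotient.mk _)
  let _ : Algebra T S := π.toAlgebra
  have hπ : Function.Surjective (algebraMap T S) :=
    φ.symm.surjective.comp Ideal.Quotient.mk_surjective
  have hker : RingHom.ker (algebraMap T S) = Ideal.span {f} := by
    ext x
    rw [RingHom.mem_ker, ← Ideal.Quotient.eq_zero_iff_mem]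
    exact φ.symm.map_eq_zero_iff
  have hm : (maximalIdeal R).map (algebraMap R S) = maximalIdeal S :=
    AdicCompletion.maximalIdeal_eq_map.symm
  have hd : ringKrullDim R = (3 : ℕ) := hdim
  constructor
  · intro hMCM
    have he' : 3 ≤ 2 * e := by
      rw [hd] at he
      exact_mod_cast he
    -- The degrees `2e + 1` and `2e + 2` become `2k + 3` and `2k + 4`, within the periodic range of
    -- the resolution.
    obtain ⟨k, rfl⟩ : ∃ k, e = k + 1 := ⟨e - 1, by omega⟩
    refine free_of_torLength_eq hm hπ hker hfm hf hd hfree hMCM (even_two_mul k) ?_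
    have := sub_eq_zero.1 hθ
    exact_mod_cast this
  · intro hN
    obtain ⟨rs, hlen, hmem, hreg⟩ := exists_isWeaklyRegular_of_hypersurface hm hπ hker hfm hf hd
    exact IsMaximalCohenMacaulay.of_free hd rs hlen hmem hreg
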